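/- Let $\bar H\ge 0$ act on $\mathbb C^d\otimes\mathbb C^d$, and for $\bar\ell\ge 1$ let $\bar H^S=\sum_{i=0}^{\bar\ell-2} \mathsf I^{\otimes \bar\ell-2-i}\otimes\bar H\otimes \mathsf I^{\otimes i}$ be the Hamiltonian of an open segment of $\bar\ell$ spins. Assume frustration freeness: $\ker\bar H^S\neq\{0\}$ for every $\bar\ell$. Let $\bar P$ be the orthogonal projector onto $\ker \bar H^S$, and on two adjacent segments let $\bar h=(\bar P\otimes\bar P)(\mathsf I^{\otimes\bar\ell-1}\otimes\bar H\otimes \mathsf I^{\otimes\bar\ell-1})(\bar P\otimes\bar P)$. For $n$ segments of length $\bar\ell$ let $H^S$ be the sum of the segment Hamiltonians, $H^L$ the sum of the links $\mathsf I^{\otimes\bar\ell-1}\otimes\bar H\otimes \mathsf I^{\otimes\bar\ell-1}$ between adjacent segments, $H=H^S+H^L$, $P^S=\bar P^{\otimes n}$ and $h=P^SH^LP^S$. The gap of a Hermitian operator is the difference of its two smallest distinct eigenvalues ($+\infty$ if there is only one eigenvalue), $\lambda_0\le\lambda_1\le\cdots$ are the eigenvalues with multiplicity (with $\lambda_k=+\infty$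 if $k$ is at least the dimension), $\|\cdot\|$ is the operator norm, and, for fixed $\bar\ell$, $H$ is gapped if its gap has a positive lower bound independent of $n$. Suppose the chain has decaying correlations: for every $\bar\ell\ge 1$ there is given a decomposition $\bar h=\tilde h+\bar k$ with $\tilde h\ge 0$ and $[\bar P\otimes\tilde h,\tilde h\otimes\bar P]=0$, such that for every $\Delta>0$ there is a segment length $\bar\ell$ with $\|\bar k\|\le\Delta$. Let $\bar g$ be the gap of $\bar h$, let $z=\dim\ker(\bar h\otimes\bar P+\bar P\otimes\bar h)$, and let $\tilde g$ be a real number (depending on $\bar\ell$) with $\tilde g\le\lambda_z(\tilde h\otimes\bar P+\bar P\otimes\tilde h)$. Suppose that for all sufficiently large $\bar\ell$ both $\bar g$ and $\tilde g$ are greater than a positive constant independent of $\bar\ell$. Then: (1) $H$ is gapped: there is $\Delta_0>0$ such that $\|\bar k\|\le\Delta_0$ for some $\bar\ell\ge1$, and for every $\bar\ell\ge 1$ with $\|\bar k\|\le\Delta_0$ the Hamiltonian $H$ is gapped. (2) For every $\bar\ell\ge1$ and all real $\Delta,\eta$ with $\|\bar k\|\le\Delta$, $\|\tilde h\|\le\eta$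 and $2\Delta<\tilde g$, the gap of $h$ is, for every number $n$ of segments, at least $$\bar g-\frac{4\Delta(2\eta+\Delta)}{\tilde g-2\Delta}.$$ -/

import Mathlib

open scoped Kronecker Matrix ComplexOrder Matrix.Norms.L2Operator

noncomputable section

/-! Operators on a tensor product of finite-dimensional spaces are matrices over `ℂ` whose rows and
columns are indexed by configurations: `n` spins with basis states `σ` are indexed by `Fin n → σ`,
position `0` being the leftmost tensor factor. Norms are operator norms (largest singular value). -/

section General

variable {m σ : Type*} [Fintype m] [DecidableEq m]

/-- The spectral gap: the difference between the two smallest distinct eigenvalues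
(`⊤` if there is only one eigenvalue, i.e. if there is no excited state). -/
def spectralGap (A : Matrix m m ℂ) : EReal :=
  sInf {e : EReal | ∃ a b : ℝ, IsLeast (spectrum ℝ A) a ∧ b ∈ spectrum ℝ A ∧ a < b ∧
    e = ((b - a : ℝ) : EReal)}

/-- The eigenvalue `λ_k(A)` of a Hermitian matrix `A`, where
`λ_0(A) ≤ λ_1(A) ≤ ⋯` lists all eigenvalues with multiplicity; it is `⊤` when `k` is at least the
dimension. (Mathlib's `eigenvalues₀` is listed in decreasing order.) -/
def orderedEigenvalue (A : Matrix m m ℂ) (k : ℕ) : EReal :=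
  open Classical in
  if hA : A.IsHermitian then
    if hk : k < Fintype.card m then ((hA.eigenvalues₀ (Fin.rev ⟨k, hk⟩) : ℝ) : EReal) else ⊤
  else ⊥

/-- The dimension of the kernel. -/
def kerDim (A : Matrix m m ℂ) : ℕ := Module.finrank ℂ (LinearMap.ker A.mulVecLin)

/-- The orthogonal projector onto the kernel, as a matrix. -/
def kerProj (A : Matrix m m ℂ) : Matrix m m ℂ :=
  (Matrix.toEuclideanCLM (n := m) (𝕜 := ℂ)).symm
    (LinearMap.ker (Matrix.toEuclideanLin A)).starProjection

/-- `P^{⊗ i} ⊗ K ⊗ P^{⊗ (n-2-i)}` on `n` spins, where the two-spin operator `K` acts on the adjacent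
positions `i`, `i+1`; used only for `i + 1 < n`. -/
def bondOp (n i : ℕ) (K : Matrix (σ × σ) (σ × σ) ℂ) (P : Matrix σ σ ℂ) :
    Matrix (Fin n → σ) (Fin n → σ) ℂ :=
  fun x y =>
    if h : i + 1 < n then
      K (x ⟨i, by omega⟩, x ⟨i + 1, h⟩) (y ⟨i, by omega⟩, y ⟨i + 1, h⟩) *
        ∏ j : Fin n with j.val ≠ i ∧ j.val ≠ i + 1, P (x j) (y j)
    else 0

/-- `I^{⊗ i} ⊗ A ⊗ I^{⊗ (n-1-i)}` on `n` spins, with `A` acting on the spin at position `i`. -/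
def siteOp [DecidableEq σ] (n : ℕ) (i : Fin n) (A : Matrix σ σ ℂ) :
    Matrix (Fin n → σ) (Fin n → σ) ℂ :=
  fun x y => A (x i) (y i) * ∏ j : Fin n with j ≠ i, (1 : Matrix σ σ ℂ) (x j) (y j)

/-- `P^{⊗ n}`. -/
def tensorPow (n : ℕ) (P : Matrix σ σ ℂ) : Matrix (Fin n → σ) (Fin n → σ) ℂ :=
  fun x y => ∏ j : Fin n, P (x j) (y j)

/-- `K ⊗ P` on three spins, `K` acting on the first two. -/
def leftOp (K : Matrix (σ × σ) (σ × σ) ℂ) (P : Matrix σ σ ℂ) :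
    Matrix (σ × σ × σ) (σ × σ × σ) ℂ :=
  Matrix.reindex (Equiv.prodAssoc σ σ σ) (Equiv.prodAssoc σ σ σ) (K ⊗ₖ P)

/-- `P ⊗ K` on three spins, `K` acting on the last two. -/
def rightOp (K : Matrix (σ × σ) (σ × σ) ℂ) (P : Matrix σ σ ℂ) :
    Matrix (σ × σ × σ) (σ × σ × σ) ℂ :=
  P ⊗ₖ K

end General

/-- A family of Hamiltonians indexed by the system size is gapped if its spectral gaps have a
positive lower bound independent of the size. -/
def IsGapped {ι : ℕ → Type*} [∀ n, Fintype (ι n)] [∀ n, DecidableEq (ι n)]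
    (A : ∀ n, Matrix (ι n) (ι n) ℂ) : Prop :=
  ∃ γ : ℝ, 0 < γ ∧ ∀ n, (γ : EReal) ≤ spectralGap (A n)

/-- Basis states of a segment of `l` spins, each with `d` states. -/
abbrev Seg (d l : ℕ) : Type := Fin l → Fin d

section Chain

variable {d : ℕ} (Hb : Matrix (Fin d × Fin d) (Fin d × Fin d) ℂ)

/-- The Hamiltonian of an open chain (or segment) of `l` spins:
`∑_i I^{⊗ i} ⊗ H̄ ⊗ I^{⊗ (l-2-i)}`. -/
def segHam (l : ℕ) : Matrix (Seg d l) (Seg d l) ℂ :=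
  ∑ i ∈ Finset.range (l - 1), bondOp l i Hb 1

/-- Frustration freeness: the open chain has a zero-energy state at every length. -/
def FrustrationFree : Prop :=
  ∀ l : ℕ, ∃ v : Seg d l → ℂ, v ≠ 0 ∧ segHam Hb l *ᵥ v = 0

/-- `P̄`, the projector onto the zero-energy states of a segment of length `l`. -/
def segProj (l : ℕ) : Matrix (Seg d l) (Seg d l) ℂ := kerProj (segHam Hb l)

/-- `I^{⊗ (l-1)} ⊗ H̄ ⊗ I^{⊗ (l-1)}` on two adjacent segments of length `l ≥ 1`: the coupling `H̄`
between the last spin of the left segment and the first spin of the right segment. -/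
def linkOp (l : ℕ) : Matrix (Seg d l × Seg d l) (Seg d l × Seg d l) ℂ :=
  (bondOp (l + l) (l - 1) Hb 1).submatrix
    (fun p => Fin.append p.1 p.2) (fun p => Fin.append p.1 p.2)

/-- `h̄ = (P̄ ⊗ P̄) (I^{⊗ (l-1)} ⊗ H̄ ⊗ I^{⊗ (l-1)}) (P̄ ⊗ P̄)`. -/
def hBar (l : ℕ) : Matrix (Seg d l × Seg d l) (Seg d l × Seg d l) ℂ :=
  (segProj Hb l ⊗ₖ segProj Hb l) * linkOp Hb l * (segProj Hb l ⊗ₖ segProj Hb l)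

/-- `H^S`: the sum of the Hamiltonians of `n` unlinked segments of length `l`. -/
def hamS (l n : ℕ) : Matrix (Fin n → Seg d l) (Fin n → Seg d l) ℂ :=
  ∑ s : Fin n, siteOp n s (segHam Hb l)

/-- `H^L`: the sum of the links between adjacent segments. -/
def hamL (l n : ℕ) : Matrix (Fin n → Seg d l) (Fin n → Seg d l) ℂ :=
  ∑ s ∈ Finset.range (n - 1), bondOp n s (linkOp Hb l) 1

/-- `H = H^S + H^L`, the Hamiltonian of `n` linked segments of length `l`. -/
def ham (l n : ℕ) : Matrix (Fin n → Seg d l) (Fin n → Seg d l) ℂ :=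
  hamS Hb l n + hamL Hb l n

/-- The renormalized Hamiltonian `h = P^S H^L P^S` with `P^S = P̄^{⊗ n}`. -/
def renHam (l n : ℕ) : Matrix (Fin n → Seg d l) (Fin n → Seg d l) ℂ :=
  tensorPow n (segProj Hb l) * hamL Hb l n * tensorPow n (segProj Hb l)

/-- Decaying correlations, witnessed by operators `h̃` (one for each segment length):
`h̃ ≥ 0`, `[P̄ ⊗ h̃, h̃ ⊗ P̄] = 0`, and for any `Δ > 0` a segment length can be found
such that `k̄ = h̄ - h̃` has norm at most `Δ`. -/
structure DecayingCorrelations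
    (ht : ∀ l : ℕ, Matrix (Seg d l × Seg d l) (Seg d l × Seg d l) ℂ) : Prop where
  nonneg : ∀ l : ℕ, 1 ≤ l → (ht l).PosSemidef
  commute : ∀ l : ℕ, 1 ≤ l →
    Commute (rightOp (ht l) (segProj Hb l)) (leftOp (ht l) (segProj Hb l))
  small : ∀ Δ : ℝ, 0 < Δ → ∃ l : ℕ, 1 ≤ l ∧ ‖hBar Hb l - ht l‖ ≤ Δ

end Chain

end

open scoped MatrixOrder
set_option linter.unusedSectionVars false

/-! ### Spectral gaps as quadratic operator inequalities -/

section Spectrum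

variable {m : Type*} [Fintype m] [DecidableEq m] {A : Matrix m m ℂ}

/-! For a positive operator `A` with a zero mode, having gap at least `γ` amounts to `γ • A ≤ A *
A`. The proof works with this inequality, because it behaves well for sums of local terms.

Write `h = ∑ h_s`, where `h_s` is `h̄` on segments `s`, `s + 1` tensored with `P̄` elsewhere. In
`h²` the squares give `ḡ ∑ h_s`, and products of non-adjacent terms are products of commuting
positive operators, hence positive. Only the anticommutators of adjacent terms can be negative. For
`A = h̄ ⊗ P̄` and `B = P̄ ⊗ h̄`, replacing `h̄` by `h̃` makes the anticommutator positive, so `AB +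
BA ≥ -r` with `r = 2Δ(2η + Δ)` (`neg_smul_one_le_anticommutator`). Since `A` and `B` live on the
complement of `ker (A + B)`, where `A + B ≥ g̃ - 2Δ` by a Weyl-type bound
(`smul_le_mul_self_of_orderedEigenvalue`), this improves to `AB + BA ≥ -ε (A + B)` with `ε = r / (g̃
- 2Δ)` (`neg_smul_add_le_anticommutator`). Each bond has at most two neighbours, so the gap of `h`
is at least `ḡ - 2ε` (`smul_sum_le_sum_mul_sum`), which is (2).

For (1), `W = (1 - P^S) + h` inherits the gap of `h`, because its two summands are orthogonal. It
satisfies `W ≤ C • H` with `C` independent of `n` (`exists_le_smul_ham`), and `H` vanishes on `ker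
W`. Hence `H` is gapped (`isGapped_ham_of_renHam`). Frustration freeness puts the ground energies at
zero throughout. -/

theorem Matrix.nonneg_of_mem_spectrum (hA : 0 ≤ A) {x : ℝ} (hx : x ∈ spectrum ℝ A) : 0 ≤ x :=
  spectrum_nonneg_of_nonneg hA hx

/-- By functional calculus the operator inequality is `γ x ≤ x²` pointwise on a nonnegative
spectrum. The eigenvalue `0` imposes no condition. -/
theorem smul_le_mul_self_iff (hA : 0 ≤ A) (γ : ℝ) :
    γ • A ≤ A * A ↔ ∀ x ∈ spectrum ℝ A, x ≠ 0 → γ ≤ x := by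
  have hsa : IsSelfAdjoint A := .of_nonneg hA
  have h1 : γ • A = cfc (fun x : ℝ => γ * x) A := by
    rw [cfc_const_mul_id γ A]
  have h2 : A * A = cfc (fun x : ℝ => x * x) A := by
    rw [cfc_mul (fun x : ℝ => x) (fun x : ℝ => x) A, cfc_id' ℝ A]
  rw [h1, h2, cfc_le_iff (fun x : ℝ => γ * x) (fun x : ℝ => x * x) A]
  refine forall₂_congr fun x hx => ?_
  rcases (Matrix.nonneg_of_mem_spectrum hA hx).eq_or_lt with rfl | h
  · simp
  · simp [h.ne', mul_le_mul_iff_left₀ h]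

theorem le_spectralGap {γ : ℝ} (hA : 0 ≤ A) (h0 : (0 : ℝ) ∈ spectrum ℝ A) (h : γ • A ≤ A * A) :
    (γ : EReal) ≤ spectralGap A := by
  refine le_sInf ?_
  rintro e ⟨a, b, ha, hb, hab, rfl⟩
  have ha0 : a = 0 := le_antisymm (ha.2 h0) (Matrix.nonneg_of_mem_spectrum hA ha.1)
  subst ha0
  simpa using (smul_le_mul_self_iff hA γ).1 h b hb hab.ne'

theorem smul_le_mul_self_of_le_spectralGap {γ : ℝ} (hA : 0 ≤ A) (h0 : (0 : ℝ) ∈ spectrum ℝ A)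
    (h : (γ : EReal) ≤ spectralGap A) : γ • A ≤ A * A := by
  refine (smul_le_mul_self_iff hA γ).2 fun x hx hx0 => ?_
  have := h.trans (sInf_le ⟨0, x, ⟨h0, fun y hy => Matrix.nonneg_of_mem_spectrum hA hy⟩, hx,
    (Matrix.nonneg_of_mem_spectrum hA hx).lt_of_ne' hx0, rfl⟩)
  simpa using this

/-- The spectrum is finite. The constant depends on `A`, so this serves only operators on a fixed
number of segments. -/
theorem exists_pos_smul_le_mul_self (hA : 0 ≤ A) : ∃ γ : ℝ, 0 < γ ∧ γ • A ≤ A * A := by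
  have hfin : (spectrum ℝ A \ {0}).Finite := A.finite_real_spectrum.subset Set.sdiff_subset
  rcases (spectrum ℝ A \ {0}).eq_empty_or_nonempty with he | hne
  · refine ⟨1, one_pos, (smul_le_mul_self_iff hA 1).2 fun x hx hx0 => ?_⟩
    exact absurd (show x ∈ spectrum ℝ A \ {0} from ⟨hx, hx0⟩) (by simp [he])
  · obtain ⟨γ, hγ, hmin⟩ := hfin.exists_minimalFor id _ hne
    refine ⟨γ, (Matrix.nonneg_of_mem_spectrum hA hγ.1).lt_of_ne' hγ.2,
      (smul_le_mul_self_iff hA γ).2 fun x hx hx0 => ?_⟩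
    exact (le_total γ x).elim id fun h => hmin ⟨hx, hx0⟩ h

theorem zero_mem_spectrum_of_mulVec_eq_zero {v : m → ℂ} (hv : v ≠ 0) (h : A *ᵥ v = 0) :
    (0 : ℝ) ∈ spectrum ℝ A := by
  rw [spectrum.zero_mem_iff]
  intro hu
  obtain ⟨u, rfl⟩ := hu
  apply hv
  calc v = ((u⁻¹ : (Matrix m m ℂ)ˣ) : Matrix m m ℂ) *ᵥ ((u : Matrix m m ℂ) *ᵥ v) := by
        simp [Matrix.mulVec_mulVec]
    _ = 0 := by rw [h, Matrix.mulVec_zero]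

theorem exists_mulVec_eq_smul_of_mem_spectrum {b : ℝ} (hb : b ∈ spectrum ℝ A) :
    ∃ v : m → ℂ, v ≠ 0 ∧ A *ᵥ v = b • v := by
  have h1 : ¬ IsUnit (algebraMap ℝ (Matrix m m ℂ) b - A) := hb
  rw [Matrix.isUnit_iff_isUnit_det, isUnit_iff_ne_zero, not_not] at h1
  obtain ⟨v, hv, h⟩ := Matrix.exists_mulVec_eq_zero_iff.2 h1
  refine ⟨v, hv, ?_⟩
  rw [Matrix.sub_mulVec, sub_eq_zero] at h
  rw [← h, Algebra.algebraMap_eq_smul_one, Matrix.smul_mulVec, Matrix.one_mulVec]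

end Spectrum

/-! ### Kernel projectors -/

section KerProj

variable {m : Type*} [Fintype m] [DecidableEq m] {A : Matrix m m ℂ}

theorem toEuclideanCLM_kerProj (A : Matrix m m ℂ) :
    Matrix.toEuclideanCLM (n := m) (𝕜 := ℂ) (kerProj A) =
      (LinearMap.ker (Matrix.toEuclideanLin A)).starProjection := by
  simp [kerProj]

theorem isStarProjection_kerProj (A : Matrix m m ℂ) : IsStarProjection (kerProj A) := by
  have h : IsStarProjection (LinearMap.ker (Matrix.toEuclideanLin A)).starProjection :=
    isStarProjection_starProjection
  refine ⟨?_, ?_⟩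
  · rw [IsIdempotentElem, kerProj, ← map_mul, h.isIdempotentElem.eq]
  · refine (Matrix.toEuclideanCLM (n := m) (𝕜 := ℂ)).injective ?_
    change Matrix.toEuclideanCLM (n := m) (𝕜 := ℂ) _ = Matrix.toEuclideanCLM (n := m) (𝕜 := ℂ) _
    have h2 := (Matrix.toEuclideanCLM (n := m) (𝕜 := ℂ)).map_star' (kerProj A)
    refine h2.trans ?_
    change star (Matrix.toEuclideanCLM (n := m) (𝕜 := ℂ) _) = _
    rw [toEuclideanCLM_kerProj, h.isSelfAdjoint.star_eq]

theorem mul_kerProj (A : Matrix m m ℂ) : A * kerProj A = 0 := by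
  refine (Matrix.toEuclideanCLM (n := m) (𝕜 := ℂ)).injective ?_
  change Matrix.toEuclideanCLM (n := m) (𝕜 := ℂ) _ = Matrix.toEuclideanCLM (n := m) (𝕜 := ℂ) 0
  rw [map_mul, toEuclideanCLM_kerProj, map_zero]
  ext1 v
  have : (LinearMap.ker (Matrix.toEuclideanLin A)).starProjection v ∈
    LinearMap.ker (Matrix.toEuclideanLin A) := Submodule.starProjection_apply_mem _ _
  exact this

theorem kerProj_mul_of_mul_eq_zero {B : Matrix m m ℂ} (h : A * B = 0) : kerProj A * B = B := by
  refine (Matrix.toEuclideanCLM (n := m) (𝕜 := ℂ)).injective ?_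
  change Matrix.toEuclideanCLM (n := m) (𝕜 := ℂ) _ = Matrix.toEuclideanCLM (n := m) (𝕜 := ℂ) B
  rw [map_mul, toEuclideanCLM_kerProj]
  ext1 v
  rw [mul_apply_eq_comp]
  refine Submodule.starProjection_eq_self_iff.2 ?_
  have := congrArg (fun T => Matrix.toEuclideanCLM (n := m) (𝕜 := ℂ) T v) h
  have h2 : Matrix.toEuclideanCLM (n := m) (𝕜 := ℂ) A
      (Matrix.toEuclideanCLM (n := m) (𝕜 := ℂ) B v) = 0 := by simpa using this
  exact h2

/-- This allows the projector to be compared with `A` itself inside the functional calculus. With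
`Q` the calculus of the indicator of `0`, `A * Q = 0` gives one inclusion of ranges, and `1 - Q =
A⁻¹ * A` (with `0⁻¹ = 0`) the other. -/
theorem kerProj_eq_cfc (hA : IsSelfAdjoint A) :
    kerProj A = cfc (fun x : ℝ => if x = 0 then 1 else 0) A := by
  have hc (f : ℝ → ℝ) : ContinuousOn f (spectrum ℝ A) := A.finite_real_spectrum.continuousOn f
  set Q := cfc (fun x : ℝ => if x = 0 then (1 : ℝ) else 0) A with hQ
  have hQsa : star Q = Q := cfc_predicate (R := ℝ) (p := IsSelfAdjoint) _ A
  have hPsa : star (kerProj A) = kerProj A := (isStarProjection_kerProj A).isSelfAdjoint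
  have hid : cfc (fun x : ℝ => x) A = A := cfc_id' ℝ A
  have h1 : A * Q = 0 := by
    calc A * Q = cfc (fun x : ℝ => x) A * Q := by rw [hid]
      _ = cfc (fun x : ℝ => x * if x = 0 then 1 else 0) A := by
        rw [hQ, ← cfc_mul _ _ _ (hc _) (hc _)]
      _ = cfc (fun _ : ℝ => 0) A := cfc_congr fun x _ => by by_cases hx : x = 0 <;> simp [hx]
      _ = 0 := by simp
  have h2 : 1 - Q = cfc (fun x : ℝ => x⁻¹) A * A := by
    calc 1 - Q = cfc (fun x : ℝ => 1 - if x = 0 then 1 else 0) A := by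
          rw [cfc_sub _ _ _ (hc _) (hc _), cfc_const_one ℝ A]
      _ = cfc (fun x : ℝ => x⁻¹ * x) A := cfc_congr fun x _ => by by_cases hx : x = 0 <;> simp [hx]
      _ = cfc (fun x : ℝ => x⁻¹) A * A := by rw [cfc_mul _ _ _ (hc _) (hc _), hid]
  have h3 : Q * kerProj A = kerProj A := by
    have : (1 - Q) * kerProj A = 0 := by rw [h2, mul_assoc, mul_kerProj, mul_zero]
    rw [sub_mul, one_mul, sub_eq_zero] at this
    exact this.symm
  have h4 := congrArg star (kerProj_mul_of_mul_eq_zero h1)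
  rw [star_mul, hQsa, hPsa] at h4
  rw [← h3, h4]

theorem smul_one_sub_kerProj_le {γ : ℝ} (hA : 0 ≤ A) (h : γ • A ≤ A * A) :
    γ • (1 - kerProj A) ≤ A := by
  have hsa : IsSelfAdjoint A := .of_nonneg hA
  have hc (f : ℝ → ℝ) : ContinuousOn f (spectrum ℝ A) := A.finite_real_spectrum.continuousOn f
  have h1 : γ • (1 - kerProj A) = cfc (fun x : ℝ => γ * (1 - if x = 0 then 1 else 0)) A := by
    rw [kerProj_eq_cfc hsa, cfc_const_mul _ _ _ (hc _), cfc_sub _ _ _ (hc _) (hc _),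
      cfc_const_one ℝ A]
  rw [h1]
  conv_rhs => rw [← cfc_id' ℝ A]
  refine (cfc_le_iff _ _ _ (hc _) (hc _)).2 fun x hx => ?_
  by_cases hx0 : x = 0
  · simp [hx0]
  · simpa [hx0] using (smul_le_mul_self_iff hA γ).1 h x hx hx0

/-- Factor `A = C* C`; the hypothesis then reads `(C B)* (C B) = 0`, so `C B = 0`. -/
theorem Matrix.mul_eq_zero_of_star_mul_mul_eq_zero {A B : Matrix m m ℂ} (hA : 0 ≤ A)
    (h : star B * A * B = 0) : A * B = 0 := by
  obtain ⟨C, rfl⟩ := CStarAlgebra.nonneg_iff_eq_star_mul_self.1 hA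
  have : star (C * B) * (C * B) = 0 := by rw [star_mul, ← h]; simp only [mul_assoc]
  rw [mul_assoc, (CStarRing.star_mul_self_eq_zero_iff _).1 this, mul_zero]

theorem Matrix.mul_eq_zero_of_le {A B C : Matrix m m ℂ} (hA : 0 ≤ A) (hAB : A ≤ B)
    (h : B * C = 0) : A * C = 0 := by
  refine Matrix.mul_eq_zero_of_star_mul_mul_eq_zero hA (le_antisymm ?_ (star_left_conjugate_nonneg hA C))
  refine (star_left_conjugate_le_conjugate hAB C).trans ?_
  rw [mul_assoc, h, mul_zero]

end KerProj

/-! ### Stability of the first excited level under perturbation -/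

section Weyl

variable {m : Type*} [Fintype m] [DecidableEq m]

omit [DecidableEq m] in
theorem star_dotProduct_mulVec_mono {A B : Matrix m m ℂ} (h : A ≤ B) (w : m → ℂ) :
    (star w ⬝ᵥ (A *ᵥ w)).re ≤ (star w ⬝ᵥ (B *ᵥ w)).re := by
  have := (Matrix.le_iff.1 h).re_dotProduct_nonneg w
  rw [Matrix.sub_mulVec, dotProduct_sub, map_sub] at this
  simpa using this

omit [DecidableEq m] in
theorem star_dotProduct_self_re_pos {w : m → ℂ} (hw : w ≠ 0) : 0 < (star w ⬝ᵥ w).re := by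
  have := Matrix.dotProduct_star_self_pos_iff.2 hw
  exact (Complex.lt_def.1 this).1

theorem le_star_dotProduct_mulVec_of_orthogonal {X : Matrix m m ℂ} (hX : X.IsHermitian) {g : ℝ}
    {w : m → ℂ}
    (h : ∀ i, hX.eigenvalues i < g → inner ℂ (hX.eigenvectorBasis i) (WithLp.toLp 2 w) = 0) :
    g * (star w ⬝ᵥ w).re ≤ (star w ⬝ᵥ (X *ᵥ w)).re := by
  set b := hX.eigenvectorBasis
  set u : EuclideanSpace ℂ m := WithLp.toLp 2 w
  have h1 (i : m) : inner ℂ (b i) (WithLp.toLp 2 (X *ᵥ w)) = hX.eigenvalues i * inner ℂ (b i) u := by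
    simp only [EuclideanSpace.inner_eq_star_dotProduct, u]
    have h2 : star (b i).ofLp ᵥ* X = star (X *ᵥ (b i).ofLp) := by
      rw [Matrix.star_mulVec, hX.eq]
    rw [dotProduct_comm, Matrix.dotProduct_mulVec, h2, hX.mulVec_eigenvectorBasis, dotProduct_comm w]
    simp [star_smul, smul_dotProduct, b]
  have h2 : (star w ⬝ᵥ (X *ᵥ w)) = ∑ i, (hX.eigenvalues i : ℂ) * (inner ℂ u (b i) * inner ℂ (b i) u) := by
    have := b.sum_inner_mul_inner u (WithLp.toLp 2 (X *ᵥ w))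
    rw [EuclideanSpace.inner_eq_star_dotProduct, dotProduct_comm] at this
    refine this.symm.trans (Finset.sum_congr rfl fun i _ => ?_)
    rw [h1]; ring
  have h3 : (star w ⬝ᵥ w) = ∑ i, (inner ℂ u (b i) * inner ℂ (b i) u) := by
    have := b.sum_inner_mul_inner u u
    rw [EuclideanSpace.inner_eq_star_dotProduct, dotProduct_comm] at this
    exact this.symm
  rw [h2, h3, Complex.re_sum, Complex.re_sum, Finset.mul_sum]
  refine Finset.sum_le_sum fun i _ => ?_
  have h4 : inner ℂ u (b i) * inner ℂ (b i) u = ((‖inner ℂ (b i) u‖ ^ 2 : ℝ) : ℂ) := by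
    rw [← inner_conj_symm u (b i), mul_comm, Complex.mul_conj, Complex.normSq_eq_norm_sq]
  rw [h4, ← Complex.ofReal_mul, Complex.ofReal_re, Complex.ofReal_re]
  rcases lt_or_ge (hX.eigenvalues i) g with hi | hi
  · simp [h i hi]
  · gcongr

/-- An eigenvalue below `g ≤ λ_z` must have increasing index below `z`; `Fin.rev` converts from the
decreasing order of `eigenvalues₀`. -/
theorem card_eigenvalues_lt_le {X : Matrix m m ℂ} (hX : X.IsHermitian) {g : ℝ} {z : ℕ}
    (hg : (g : EReal) ≤ orderedEigenvalue X z) :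
    Fintype.card {i // hX.eigenvalues i < g} ≤ z := by
  classical
  by_cases hz : z < Fintype.card m
  · rw [orderedEigenvalue, dif_pos hX, dif_pos hz, EReal.coe_le_coe_iff] at hg
    let f : {i // hX.eigenvalues i < g} → Fin z := fun i =>
      ⟨(Fin.rev ((Fintype.equivOfCardEq (Fintype.card_fin _)).symm i.1 : Fin (Fintype.card m))).1, by
        by_contra hcon
        have h1 : ((Fintype.equivOfCardEq (Fintype.card_fin _)).symm i.1 : Fin (Fintype.card m)) ≤
            Fin.rev ⟨z, hz⟩ := by
          rw [← Fin.rev_le_rev, Fin.rev_rev]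
          exact not_lt.1 hcon
        exact absurd (hg.trans (hX.eigenvalues₀_antitone h1)) (not_le.2 i.2)⟩
    have hf : Function.Injective f := by
      intro i j hij
      have := Fin.rev_injective (Fin.ext (Fin.mk.inj_iff.1 hij))
      exact Subtype.ext ((Equiv.injective _) this)
    simpa using Fintype.card_le_of_injective f hf
  · exact (Fintype.card_subtype_le _).trans (not_lt.1 hz)

/-- A min-max argument. For a nonzero eigenvalue `b` of `Y`, the span of `ker Y` and the
`b`-eigenspace has dimension exceeding `dim ker Y`, so it contains a nonzero `w` orthogonal to every
eigenvector of `X` below `g`. Then `g‖w‖² ≤ ⟨w, X w⟩ ≤ ⟨w, Y w⟩ + δ‖w‖² ≤ (b + δ)‖w‖²`. -/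
theorem smul_le_mul_self_of_orderedEigenvalue {X Y : Matrix m m ℂ} {g δ : ℝ} (hY : 0 ≤ Y)
    (hXY : ‖X - Y‖ ≤ δ) (hg : (g : EReal) ≤ orderedEigenvalue X (kerDim Y)) :
    (g - δ) • Y ≤ Y * Y := by
  by_cases hX : X.IsHermitian
  swap
  · simp [orderedEigenvalue, hX] at hg
  refine (smul_le_mul_self_iff hY _).2 fun b hb hb0 => ?_
  have hbpos : 0 < b := (Matrix.nonneg_of_mem_spectrum hY hb).lt_of_ne' hb0
  obtain ⟨v, hv, hYv⟩ := exists_mulVec_eq_smul_of_mem_spectrum hb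
  -- The kernel of `Y (Y - b)` is the sum of the kernel and the `b`-eigenspace.
  set Z := Y * Y - b • Y with hZ
  set V := LinearMap.ker Z.mulVecLin with hV
  have hlt : LinearMap.ker Y.mulVecLin < V := by
    refine SetLike.lt_iff_le_and_exists.2 ⟨fun w hw => ?_, v, ?_, ?_⟩
    · have hw : Y *ᵥ w = 0 := hw
      change Z *ᵥ w = 0
      rw [hZ, Matrix.sub_mulVec, ← Matrix.mulVec_mulVec, Matrix.smul_mulVec, hw]
      simp
    · change Z *ᵥ v = 0
      rw [hZ, Matrix.sub_mulVec, ← Matrix.mulVec_mulVec, Matrix.smul_mulVec, hYv, Matrix.mulVec_smul,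
        hYv, sub_self]
    · intro h
      have h : Y *ᵥ v = 0 := h
      rw [hYv] at h
      exact (smul_ne_zero hb0 hv) h
  let f : V →ₗ[ℂ] ({i // hX.eigenvalues i < g} → ℂ) := LinearMap.pi fun i =>
    ((innerSL ℂ (hX.eigenvectorBasis i.1)).toLinearMap ∘ₗ
      (WithLp.linearEquiv 2 ℂ (m → ℂ)).symm.toLinearMap) ∘ₗ V.subtype
  have hker : LinearMap.ker f ≠ ⊥ := by
    apply LinearMap.ker_ne_bot_of_finrank_lt
    rw [Module.finrank_fintype_fun_eq_card]
    exact (card_eigenvalues_lt_le hX hg).trans_lt (Submodule.finrank_lt_finrank_of_lt hlt)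
  obtain ⟨⟨w, hwV⟩, hwf, hw0⟩ := Submodule.exists_mem_ne_zero_of_ne_bot hker
  have hw0 : w ≠ 0 := fun h => hw0 (Subtype.ext h)
  have hort : ∀ i, hX.eigenvalues i < g →
      inner ℂ (hX.eigenvectorBasis i) (WithLp.toLp 2 w) = 0 := fun i hi => congrFun hwf ⟨i, hi⟩
  have hn := star_dotProduct_self_re_pos hw0
  have hge := le_star_dotProduct_mulVec_of_orthogonal hX hort
  have hXY' : X ≤ Y + δ • 1 := by
    have hsa : IsSelfAdjoint (X - Y) := IsSelfAdjoint.sub hX (.of_nonneg hY)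
    have h1 : X - Y ≤ algebraMap ℝ _ ‖X - Y‖ := hsa.le_algebraMap_norm_self
    have h2 : algebraMap ℝ (Matrix m m ℂ) ‖X - Y‖ ≤ algebraMap ℝ _ δ := algebraMap_mono _ hXY
    rw [← sub_le_iff_le_add']
    simpa [Algebra.algebraMap_eq_smul_one] using h1.trans h2
  have hle := star_dotProduct_mulVec_mono hXY' w
  have hsq : (0 : Matrix m m ℂ) ≤ (Y - b • 1) * (Y - b • 1) := by
    have : IsSelfAdjoint (Y - b • (1 : Matrix m m ℂ)) :=
      (IsSelfAdjoint.of_nonneg hY).sub ((IsSelfAdjoint.all b).smul (.one _))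
    exact this.mul_self_nonneg
  have hZw : Z *ᵥ w = 0 := hwV
  -- Since `Z w = 0`, positivity of `(Y - b)²` at `w` yields `⟨w, Y w⟩ ≤ b‖w‖²`.
  have hYY : (Y - b • 1) * (Y - b • 1) = Z + b • (b • 1 - Y) := by
    rw [hZ]; simp only [sub_mul, mul_sub, smul_sub]; simp; abel
  have hY2 := star_dotProduct_mulVec_mono hsq w
  rw [hYY, Matrix.add_mulVec, hZw] at hY2
  simp only [Matrix.zero_mulVec, Matrix.add_mulVec, Matrix.sub_mulVec, Matrix.smul_mulVec, zero_add,
    Matrix.one_mulVec, dotProduct_add, dotProduct_sub, dotProduct_smul, dotProduct_zero,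
    Complex.add_re, Complex.sub_re, Complex.smul_re, Complex.zero_re, smul_eq_mul] at hY2 hle
  have h5 := nonneg_of_mul_nonneg_right hY2 hbpos
  nlinarith

end Weyl

/-! ### Anticommutator bounds and the gap of a sum of local terms -/

section Anticommutator

variable {m : Type*} [Fintype m] [DecidableEq m]

/-- The commuting positive pair contributes `2 A' B' ≥ 0`. The remainder `W` consists of four terms
of norm at most `η δ` and two of norm at most `δ²`. -/
theorem neg_smul_one_le_anticommutator {A B A' B' : Matrix m m ℂ} {η δ : ℝ}
    (hA : IsSelfAdjoint A) (hB : IsSelfAdjoint B) (hA' : 0 ≤ A') (hB' : 0 ≤ B')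
    (hAB : Commute A' B') (hAη : ‖A'‖ ≤ η) (hBη : ‖B'‖ ≤ η) (hAδ : ‖A - A'‖ ≤ δ)
    (hBδ : ‖B - B'‖ ≤ δ) :
    -((2 * δ * (2 * η + δ)) • (1 : Matrix m m ℂ)) ≤ A * B + B * A := by
  set K := A - A' with hK
  set L := B - B' with hL
  have hδ : 0 ≤ δ := (norm_nonneg _).trans hAδ
  have hη : 0 ≤ η := (norm_nonneg _).trans hAη
  have hKs : IsSelfAdjoint K := hA.sub (.of_nonneg hA')
  have hLs : IsSelfAdjoint L := hB.sub (.of_nonneg hB')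
  have hA's : IsSelfAdjoint A' := .of_nonneg hA'
  have hB's : IsSelfAdjoint B' := .of_nonneg hB'
  set W := A' * L + K * B' + K * L + (L * A' + B' * K + L * K) with hW
  have hWs : IsSelfAdjoint W := by
    rw [IsSelfAdjoint, hW]
    simp only [star_add, star_mul, hKs.star_eq, hLs.star_eq, hA's.star_eq, hB's.star_eq]
    abel
  have hWn : ‖W‖ ≤ 2 * δ * (2 * η + δ) := by
    have e1 : ‖A' * L‖ ≤ η * δ := norm_mul_le_of_le hAη hBδ
    have e2 : ‖K * B'‖ ≤ δ * η := norm_mul_le_of_le hAδ hBη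
    have e3 : ‖K * L‖ ≤ δ * δ := norm_mul_le_of_le hAδ hBδ
    have e4 : ‖L * A'‖ ≤ δ * η := norm_mul_le_of_le hBδ hAη
    have e5 : ‖B' * K‖ ≤ η * δ := norm_mul_le_of_le hBη hAδ
    have e6 : ‖L * K‖ ≤ δ * δ := norm_mul_le_of_le hBδ hAδ
    calc ‖W‖ ≤ (η * δ + δ * η + δ * δ) + (δ * η + η * δ + δ * δ) :=
          norm_add_le_of_le (norm_add_le_of_le (norm_add_le_of_le e1 e2) e3)
            (norm_add_le_of_le (norm_add_le_of_le e4 e5) e6)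
      _ = _ := by ring
  have h1 : A * B + B * A = (A' * B' + A' * B') + W := by
    have ha : A = A' + K := by rw [hK]; abel
    have hb : B = B' + L := by rw [hL]; abel
    have hc := hAB.eq
    rw [ha, hb, hW]
    simp only [add_mul, mul_add]
    rw [hc]; abel
  have h2 : 0 ≤ A' * B' := hAB.mul_nonneg hA' hB'
  have h3 : -algebraMap ℝ (Matrix m m ℂ) ‖W‖ ≤ W := hWs.neg_algebraMap_norm_le_self
  have h4 : algebraMap ℝ (Matrix m m ℂ) ‖W‖ ≤ algebraMap ℝ _ (2 * δ * (2 * η + δ)) :=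
    algebraMap_mono _ hWn
  rw [h1, ← Algebra.algebraMap_eq_smul_one]
  exact ((neg_le_neg h4).trans h3).trans (le_add_of_nonneg_left (add_nonneg h2 h2))

/-- Both `A` and `B` vanish on `ker (A + B)`, so conjugating by the complementary projector `R`
preserves the anticommutator and turns the bound `-r` into `-r R`. The gap of `A + B` gives `μ R ≤ A
+ B`. -/
theorem neg_smul_add_le_anticommutator {A B : Matrix m m ℂ} {μ r : ℝ} (hA : 0 ≤ A) (hB : 0 ≤ B)
    (hμ : 0 < μ) (hr : 0 ≤ r) (hY : μ • (A + B) ≤ (A + B) * (A + B))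
    (h : -(r • (1 : Matrix m m ℂ)) ≤ A * B + B * A) :
    -((r / μ) • (A + B)) ≤ A * B + B * A := by
  have hY0 : 0 ≤ A + B := add_nonneg hA hB
  set Q := kerProj (A + B) with hQ
  have hQp : IsStarProjection Q := isStarProjection_kerProj _
  set R := 1 - Q with hR
  have hRp : IsStarProjection R := hQp.one_sub
  have key {C : Matrix m m ℂ} (hC : 0 ≤ C) (hle : C ≤ A + B) : C * R = C ∧ R * C = C := by
    have h0 := Matrix.mul_eq_zero_of_le hC hle (mul_kerProj (A + B))
    have h1 : C * R = C := by rw [hR, mul_sub, mul_one, h0, sub_zero]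
    refine ⟨h1, ?_⟩
    have := congrArg star h1
    rwa [star_mul, (IsSelfAdjoint.of_nonneg hC).star_eq, hRp.isSelfAdjoint.star_eq] at this
  obtain ⟨a1, a2⟩ := key hA (le_add_of_nonneg_right hB)
  obtain ⟨b1, b2⟩ := key hB (le_add_of_nonneg_left hA)
  have h1 : A * B + B * A = star R * (A * B + B * A) * R := by
    rw [hRp.isSelfAdjoint.star_eq, mul_add, add_mul, ← mul_assoc, ← mul_assoc, a2, b2, mul_assoc,
      mul_assoc, a1, b1]
  have h2 := star_left_conjugate_le_conjugate h R
  rw [← h1] at h2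
  refine le_trans ?_ h2
  have h3 : star R * -(r • (1 : Matrix m m ℂ)) * R = -(r • R) := by
    simp [hRp.isSelfAdjoint.star_eq, hRp.isIdempotentElem.eq]
  rw [h3, neg_le_neg_iff]
  have h4 := smul_le_smul_of_nonneg_left (smul_one_sub_kerProj_le hY0 hY) (show 0 ≤ r / μ by positivity)
  rwa [smul_smul, div_mul_cancel₀ _ hμ.ne'] at h4

theorem smul_sum_le_sum_mul_sum {N : ℕ} {h : ℕ → Matrix m m ℂ} {γ ε : ℝ} (hε : 0 ≤ ε)
    (h0 : ∀ s < N, 0 ≤ h s) (hsq : ∀ s < N, γ • h s ≤ h s * h s)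
    (hcomm : ∀ s t, s + 1 < t → t < N → Commute (h s) (h t))
    (hanti : ∀ s, s + 1 < N → -(ε • (h s + h (s + 1))) ≤ h s * h (s + 1) + h (s + 1) * h s) :
    (γ - 2 * ε) • ∑ s ∈ Finset.range N, h s ≤
      (∑ s ∈ Finset.range N, h s) * ∑ s ∈ Finset.range N, h s := by
  -- The last bond has so far met only its left neighbour, so a spare `ε • h M` is carried along; it
  -- pays for the anticommutator with the next bond.
  have key : ∀ M, M < N → (γ - 2 * ε) • ∑ s ∈ Finset.range (M + 1), h s + ε • h M ≤
      (∑ s ∈ Finset.range (M + 1), h s) * ∑ s ∈ Finset.range (M + 1), h s := by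
    intro M
    induction M with
    | zero =>
      intro hM
      simp only [zero_add, Finset.range_one, Finset.sum_singleton]
      rw [← add_smul]
      refine le_trans (smul_le_smul_of_nonneg_right ?_ (h0 0 hM)) (hsq 0 hM)
      linarith
    | succ M ih =>
      intro hM
      rw [Finset.sum_range_succ _ (M + 1)]
      set S := ∑ s ∈ Finset.range (M + 1), h s with hS
      have h1 := ih (by omega)
      have h2 := hsq (M + 1) hM
      have h3 : -(ε • (h M + h (M + 1))) ≤ S * h (M + 1) + h (M + 1) * S := by
        have hnn (s) (hs : s ∈ Finset.range M) : 0 ≤ h s * h (M + 1) :=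
          (hcomm s (M + 1) (by have := Finset.mem_range.1 hs; omega) hM).mul_nonneg
            (h0 s (by have := Finset.mem_range.1 hs; omega)) (h0 _ hM)
        have hnn' (s) (hs : s ∈ Finset.range M) : 0 ≤ h (M + 1) * h s := by
          rw [← (hcomm s (M + 1) (by have := Finset.mem_range.1 hs; omega) hM).eq]
          exact hnn s hs
        rw [hS, Finset.sum_range_succ, add_mul, mul_add, Finset.sum_mul, Finset.mul_sum]
        refine (hanti M hM).trans ?_
        have := add_nonneg (Finset.sum_nonneg hnn) (Finset.sum_nonneg hnn')
        rw [← sub_nonneg] at this ⊢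
        convert this using 1
        abel
      have h4 := add_le_add (add_le_add h1 h2) h3
      convert h4 using 1
      · module
      · simp only [add_mul, mul_add]; abel
  rcases N with _ | N
  · simp
  · refine le_trans ?_ (key N (Nat.lt_succ_self N))
    exact le_add_of_nonneg_right (smul_nonneg hε (h0 N (Nat.lt_succ_self N)))

/-- A gap of `W` is inherited by any `H` with the same kernel that dominates a multiple of `W`. -/
theorem smul_le_mul_self_of_le_smul {H W : Matrix m m ℂ} {μ C : ℝ} (hC : 0 < C)
    (hH : 0 ≤ H) (hW : 0 ≤ W) (hWW : μ • W ≤ W * W) (hle : W ≤ C • H) (hker : H * kerProj W = 0) :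
    (μ / C) • H ≤ H * H := by
  refine (smul_le_mul_self_iff hH _).2 fun b hb hb0 => ?_
  obtain ⟨v, hv, hHv⟩ := exists_mulVec_eq_smul_of_mem_spectrum hb
  have h1 : μ • (1 - kerProj W) ≤ C • H := (smul_one_sub_kerProj_le hW hWW).trans hle
  have h2 : kerProj W *ᵥ v = 0 := by
    -- An eigenvector of `H` with nonzero eigenvalue is orthogonal to `ker W`, so on it `W`
    -- contributes at least `μ`.
    have h3 : kerProj W * H = 0 := by
      have := congrArg star hker
      rwa [star_mul, star_zero, (IsSelfAdjoint.of_nonneg hH).star_eq,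
        (isStarProjection_kerProj W).isSelfAdjoint.star_eq] at this
    have h4 : b • (kerProj W *ᵥ v) = 0 := by
      rw [← Matrix.mulVec_smul, ← hHv, Matrix.mulVec_mulVec, h3, Matrix.zero_mulVec]
    exact (smul_eq_zero.1 h4).resolve_left hb0
  have h5 := star_dotProduct_mulVec_mono h1 v
  simp only [Matrix.smul_mulVec, Matrix.sub_mulVec, Matrix.one_mulVec, h2, sub_zero, hHv,
    dotProduct_smul, Complex.smul_re, smul_eq_mul, ← mul_assoc] at h5
  rw [div_le_iff₀ hC, mul_comm b]
  exact le_of_mul_le_mul_right h5 (star_dotProduct_self_re_pos hv)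

end Anticommutator

/-! ### Embedding operators into tensor products -/

section Embed

variable {X α β : Type*} [Fintype X] [DecidableEq X] [Fintype α] [DecidableEq α] [Fintype β]
  [DecidableEq β]

/-- `A ↦ A ⊗ R` for a projection `R`, along an identification of the index set with a product. -/
def embedHom (e : X ≃ α × β) {R : Matrix β β ℂ} (hR : IsStarProjection R) :
    Matrix α α ℂ →⋆ₙₐ[ℂ] Matrix X X ℂ where
  toFun A := (A ⊗ₖ R).submatrix e e
  map_smul' c A := by rw [Matrix.smul_kronecker]; rfl
  map_zero' := by rw [Matrix.zero_kronecker]; rfl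
  map_add' A B := by rw [Matrix.add_kronecker]; rfl
  map_mul' A B := by
    rw [Matrix.submatrix_mul_equiv, ← Matrix.mul_kronecker_mul, hR.isIdempotentElem.eq]
  map_star' A := by
    have h : Rᴴ = R := hR.isSelfAdjoint
    rw [Matrix.star_eq_conjTranspose, Matrix.star_eq_conjTranspose, Matrix.conjTranspose_submatrix,
      Matrix.conjTranspose_kronecker, h]

theorem embedHom_apply (e : X ≃ α × β) {R : Matrix β β ℂ} (hR : IsStarProjection R)
    (A : Matrix α α ℂ) : embedHom e hR A = (A ⊗ₖ R).submatrix e e := rfl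

theorem embedHom_one_one (e : X ≃ α × β) :
    embedHom e (IsStarProjection.one (Matrix β β ℂ)) 1 = 1 := by
  rw [embedHom_apply, Matrix.one_kronecker_one, Matrix.submatrix_one_equiv]

theorem embedHom_mono (e : X ≃ α × β) {R : Matrix β β ℂ} (hR : IsStarProjection R)
    {A B : Matrix α α ℂ} (h : A ≤ B) : embedHom e hR A ≤ embedHom e hR B :=
  OrderHomClass.mono (embedHom e hR) h

theorem embedHom_nonneg (e : X ≃ α × β) {R : Matrix β β ℂ} (hR : IsStarProjection R)
    {A : Matrix α α ℂ} (h : 0 ≤ A) : 0 ≤ embedHom e hR A := by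
  simpa using embedHom_mono e hR h

theorem norm_embedHom_le (e : X ≃ α × β) {R : Matrix β β ℂ} (hR : IsStarProjection R)
    (A : Matrix α α ℂ) : ‖embedHom e hR A‖ ≤ ‖A‖ :=
  NonUnitalStarAlgHom.norm_apply_le (embedHom e hR) A

end Embed

/-! ### Tensor products of single-site operators -/

section PiOp

variable {ι σ : Type*} [Fintype ι] [Fintype σ] [DecidableEq σ]

/-- The tensor product of a family of operators. -/
def piOp (A : ι → Matrix σ σ ℂ) : Matrix (ι → σ) (ι → σ) ℂ := fun x y => ∏ j, A j (x j) (y j)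

theorem piOp_mul [DecidableEq ι] (A B : ι → Matrix σ σ ℂ) : piOp A * piOp B = piOp (A * B) := by
  ext x y
  simp only [Matrix.mul_apply, piOp, Pi.mul_apply]
  rw [Finset.prod_univ_sum, Fintype.piFinset_univ]
  simp [Finset.prod_mul_distrib]

theorem star_piOp (A : ι → Matrix σ σ ℂ) : star (piOp A) = piOp (star A) := by
  ext x y
  simp [piOp]

theorem piOp_one [DecidableEq ι] : piOp (1 : ι → Matrix σ σ ℂ) = 1 := by
  ext x y
  by_cases h : x = y
  · subst h; simp [piOp]
  · obtain ⟨j, hj⟩ := Function.ne_iff.1 h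
    rw [Matrix.one_apply_ne h]
    exact Finset.prod_eq_zero (Finset.mem_univ j) (Matrix.one_apply_ne hj)

theorem isStarProjection_piOp [DecidableEq ι] {A : ι → Matrix σ σ ℂ}
    (hA : ∀ i, IsStarProjection (A i)) : IsStarProjection (piOp A) := by
  refine ⟨?_, ?_⟩
  · rw [IsIdempotentElem, piOp_mul]
    congr 1
    exact funext fun i => (hA i).isIdempotentElem
  · rw [IsSelfAdjoint, star_piOp]
    congr 1
    exact funext fun i => (hA i).isSelfAdjoint

theorem commute_piOp [DecidableEq ι] {A B : ι → Matrix σ σ ℂ} (h : ∀ i, Commute (A i) (B i)) :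
    Commute (piOp A) (piOp B) := by
  rw [Commute, SemiconjBy, piOp_mul, piOp_mul]
  congr 1
  exact funext h

theorem tensorPow_eq_piOp (n : ℕ) (P : Matrix σ σ ℂ) : tensorPow n P = piOp fun _ => P := rfl

theorem isStarProjection_tensorPow (n : ℕ) {P : Matrix σ σ ℂ} (hP : IsStarProjection P) :
    IsStarProjection (tensorPow n P) := isStarProjection_piOp fun _ => hP

end PiOp

/-! ### Single-site operators -/

section Sites

variable {σ : Type*} [Fintype σ] [DecidableEq σ]

omit [Fintype σ] in
theorem siteOp_eq_piOp (n : ℕ) (i : Fin n) (A : Matrix σ σ ℂ) :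
    siteOp n i A = piOp fun j => if j = i then A else 1 := by
  ext x y
  rw [siteOp, piOp, ← Finset.mul_prod_erase _ _ (Finset.mem_univ i)]
  simp only [if_true]
  congr 1
  refine Finset.prod_congr ?_ fun j hj => ?_
  · ext j; simp
  · rw [if_neg (Finset.ne_of_mem_erase hj)]

/-- `A ↦ I ⊗ A ⊗ I` with `A` acting on the spin at position `i`. -/
def siteHom (n : ℕ) (i : Fin n) : Matrix σ σ ℂ →⋆ₙₐ[ℂ] Matrix (Fin n → σ) (Fin n → σ) ℂ :=
  embedHom (Equiv.funSplitAt i σ) (IsStarProjection.one _)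

theorem siteHom_apply (n : ℕ) (i : Fin n) (A : Matrix σ σ ℂ) : siteHom n i A = siteOp n i A := by
  rw [siteHom, embedHom_apply]
  ext x y
  rw [siteOp, ← piOp_one, Matrix.submatrix_apply, Matrix.kroneckerMap_apply, piOp]
  congr 1
  rw [Finset.prod_subtype (p := fun j => j ≠ i) _ (by simp)]
  rfl

theorem siteOp_one (n : ℕ) (i : Fin n) : siteOp n i (1 : Matrix σ σ ℂ) = 1 := by
  rw [← siteHom_apply]; exact embedHom_one_one _

theorem siteOp_nonneg (n : ℕ) (i : Fin n) {A : Matrix σ σ ℂ} (h : 0 ≤ A) : 0 ≤ siteOp n i A := by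
  rw [← siteHom_apply]; exact embedHom_nonneg _ _ h

theorem siteOp_mono (n : ℕ) (i : Fin n) {A B : Matrix σ σ ℂ} (h : A ≤ B) :
    siteOp n i A ≤ siteOp n i B := by
  rw [← siteHom_apply, ← siteHom_apply]; exact embedHom_mono _ _ h

theorem siteOp_sub (n : ℕ) (i : Fin n) (A B : Matrix σ σ ℂ) :
    siteOp n i (A - B) = siteOp n i A - siteOp n i B := by
  simp only [← siteHom_apply, map_sub]

theorem siteOp_smul (n : ℕ) (i : Fin n) (c : ℝ) (A : Matrix σ σ ℂ) :
    siteOp n i (c • A) = c • siteOp n i A := by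
  rw [← Complex.coe_smul c A, ← siteHom_apply, map_smul, siteHom_apply, Complex.coe_smul]

theorem siteOp_mul_tensorPow (n : ℕ) (i : Fin n) {A P : Matrix σ σ ℂ} (h : A * P = 0) :
    siteOp n i A * tensorPow n P = 0 := by
  rw [siteOp_eq_piOp, tensorPow_eq_piOp, piOp_mul]
  ext x y
  exact Finset.prod_eq_zero (Finset.mem_univ i) (by simp [h])

/-- A union bound for commuting projections: `1 - P^{⊗ n}` telescopes over the number `k` of leading
sites carrying `P`, and the increment at site `k` is `1 - P` there times a commuting projection. -/
theorem one_sub_tensorPow_le (n : ℕ) {P : Matrix σ σ ℂ} (hP : IsStarProjection P) :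
    1 - tensorPow n P ≤ ∑ s : Fin n, siteOp n s (1 - P) := by
  let p : ℕ → Matrix (Fin n → σ) (Fin n → σ) ℂ := fun k =>
    piOp fun j : Fin n => if j.val < k then P else 1
  have hp (k : ℕ) : IsStarProjection (p k) := isStarProjection_piOp fun j => by
    split_ifs
    exacts [hP, .one _]
  have h0 : p 0 = 1 := by simp only [p, Nat.not_lt_zero, if_false]; exact piOp_one
  have hn : p n = tensorPow n P := by simp [p, tensorPow_eq_piOp]
  have hstep (k : Fin n) : p k - p (k + 1) ≤ siteOp n k (1 - P) := by
    have h1 : p (k + 1) = p k * siteOp n k P := by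
      simp only [p]
      rw [siteOp_eq_piOp, piOp_mul]
      congr 1
      ext1 j
      simp only [Pi.mul_apply]
      rcases lt_trichotomy j k with h | h | h
      · rw [if_pos (by omega), if_pos (by omega), if_neg h.ne, mul_one]
      · subst h; simp
      · rw [if_neg (by omega), if_neg (by omega), if_neg h.ne', mul_one]
    have hcomm : Commute (1 - p k) (siteOp n k (1 - P)) := by
      refine (Commute.one_left _).sub_left ?_
      simp only [p]
      rw [siteOp_eq_piOp]
      refine commute_piOp fun j => ?_
      by_cases h : j = k
      · subst h; simp
      · simp [h]
    have h2 : p k - p (k + 1) = siteOp n k (1 - P) - (1 - p k) * siteOp n k (1 - P) := by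
      rw [h1, siteOp_sub, siteOp_one]
      simp only [sub_mul, mul_sub, one_mul, mul_one]
      abel
    rw [h2]
    exact sub_le_self _ (hcomm.mul_nonneg (hp k).one_sub.nonneg (siteOp_nonneg _ _ hP.one_sub.nonneg))
  have h3 := Finset.sum_range_sub' p n
  rw [h0, hn] at h3
  rw [← h3, ← Fin.sum_univ_eq_sum_range (fun k => p k - p (k + 1))]
  exact Finset.sum_le_sum fun k _ => hstep k

end Sites

/-! ### Two-site operators on a chain -/

section Bonds

variable {σ : Type*}

/-- Splitting off the spins at positions `i`, `i + 1`. -/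
def pairEquiv (σ : Type*) {n i : ℕ} (h : i + 1 < n) :
    (Fin n → σ) ≃ (σ × σ) × ({j : Fin n // j.val ≠ i ∧ j.val ≠ i + 1} → σ) where
  toFun x := ((x ⟨i, by omega⟩, x ⟨i + 1, h⟩), fun j => x j)
  invFun p j := if h1 : j.val = i then p.1.1 else if h2 : j.val = i + 1 then p.1.2
    else p.2 ⟨j, h1, h2⟩
  left_inv x := by
    ext1 j
    dsimp only
    split_ifs with h1 h2
    · exact congrArg x (Fin.ext h1.symm)
    · exact congrArg x (Fin.ext h2.symm)
    · rfl
  right_inv p := by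
    refine Prod.ext (Prod.ext ?_ ?_) (funext fun j => ?_)
    · simp
    · simp
    · simp [j.2.1, j.2.2]

/-- Splitting off the spins at positions `i`, `i + 1`, `i + 2`. -/
def tripleEquiv (σ : Type*) {n i : ℕ} (h : i + 2 < n) : (Fin n → σ) ≃
    (σ × σ × σ) × ({j : Fin n // j.val ≠ i ∧ j.val ≠ i + 1 ∧ j.val ≠ i + 2} → σ) where
  toFun x := ((x ⟨i, by omega⟩, x ⟨i + 1, by omega⟩, x ⟨i + 2, h⟩), fun j => x j)
  invFun p j := if h1 : j.val = i then p.1.1 else if h2 : j.val = i + 1 then p.1.2.1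
    else if h3 : j.val = i + 2 then p.1.2.2 else p.2 ⟨j, h1, h2, h3⟩
  left_inv x := by
    ext1 j
    dsimp only
    split_ifs with h1 h2 h3
    · exact congrArg x (Fin.ext h1.symm)
    · exact congrArg x (Fin.ext h2.symm)
    · exact congrArg x (Fin.ext h3.symm)
    · rfl
  right_inv p := by
    refine Prod.ext (Prod.ext ?_ (Prod.ext ?_ ?_)) (funext fun j => ?_)
    · simp
    · simp
    · simp
    · simp [j.2.1, j.2.2.1, j.2.2.2]

variable [Fintype σ] [DecidableEq σ]

theorem bondOp_eq_submatrix {n i : ℕ} (h : i + 1 < n) (K : Matrix (σ × σ) (σ × σ) ℂ)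
    (P : Matrix σ σ ℂ) :
    bondOp n i K P = (K ⊗ₖ piOp fun _ => P).submatrix (pairEquiv σ h) (pairEquiv σ h) := by
  ext x y
  rw [bondOp, dif_pos h, Matrix.submatrix_apply, Matrix.kroneckerMap_apply, piOp]
  congr 1
  rw [Finset.prod_subtype (p := fun j : Fin n => j.val ≠ i ∧ j.val ≠ i + 1) _ (by simp)]
  rfl

/-- Together with `bondOp_eq_right`, this places two adjacent bonds on a common triple of sites, so
an inequality on three sites transfers to the chain by a single embedding. -/
theorem bondOp_eq_left {n i : ℕ} (h : i + 2 < n) (K : Matrix (σ × σ) (σ × σ) ℂ)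
    (P : Matrix σ σ ℂ) : bondOp n i K P =
      (leftOp K P ⊗ₖ piOp fun _ => P).submatrix (tripleEquiv σ h) (tripleEquiv σ h) := by
  ext x y
  rw [bondOp, dif_pos (by omega), Matrix.submatrix_apply, Matrix.kroneckerMap_apply, piOp]
  have hs : (Finset.univ.filter fun j : Fin n => j.val ≠ i ∧ j.val ≠ i + 1) =
      insert ⟨i + 2, h⟩ (Finset.univ.filter fun j : Fin n => j.val ≠ i ∧ j.val ≠ i + 1 ∧ j.val ≠ i + 2) := by
    ext j; simp [Fin.ext_iff]; omega
  rw [hs, Finset.prod_insert (by simp), ← mul_assoc]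
  congr 1
  rw [Finset.prod_subtype
    (p := fun j : Fin n => j.val ≠ i ∧ j.val ≠ i + 1 ∧ j.val ≠ i + 2) _ (by simp)]
  rfl

theorem bondOp_eq_right {n i : ℕ} (h : i + 2 < n) (K : Matrix (σ × σ) (σ × σ) ℂ)
    (P : Matrix σ σ ℂ) : bondOp n (i + 1) K P =
      (rightOp K P ⊗ₖ piOp fun _ => P).submatrix (tripleEquiv σ h) (tripleEquiv σ h) := by
  ext x y
  rw [bondOp, dif_pos (by omega), Matrix.submatrix_apply, Matrix.kroneckerMap_apply, piOp]
  have hs : (Finset.univ.filter fun j : Fin n => j.val ≠ i + 1 ∧ j.val ≠ i + 1 + 1) =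
      insert ⟨i, by omega⟩ (Finset.univ.filter fun j : Fin n => j.val ≠ i ∧ j.val ≠ i + 1 ∧ j.val ≠ i + 2) := by
    ext j; simp [Fin.ext_iff]; omega
  rw [hs, Finset.prod_insert (by simp), ← mul_assoc, mul_comm (K _ _)]
  congr 1
  rw [Finset.prod_subtype
    (p := fun j : Fin n => j.val ≠ i ∧ j.val ≠ i + 1 ∧ j.val ≠ i + 2) _ (by simp)]
  rfl

theorem bondOp_mul {n i : ℕ} (h : i + 1 < n) (K K' : Matrix (σ × σ) (σ × σ) ℂ)
    (P P' : Matrix σ σ ℂ) :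
    bondOp n i K P * bondOp n i K' P' = bondOp n i (K * K') (P * P') := by
  rw [bondOp_eq_submatrix h, bondOp_eq_submatrix h, bondOp_eq_submatrix h,
    Matrix.submatrix_mul_equiv, ← Matrix.mul_kronecker_mul, piOp_mul]
  rfl

theorem bondOp_kronecker {n i : ℕ} (h : i + 1 < n) (A B P : Matrix σ σ ℂ) :
    bondOp n i (A ⊗ₖ B) P =
      piOp fun j : Fin n => if j.val = i then A else if j.val = i + 1 then B else P := by
  ext x y
  rw [bondOp, dif_pos h, piOp, ← Finset.mul_prod_erase _ _ (Finset.mem_univ (⟨i, by omega⟩ : Fin n)),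
    ← Finset.mul_prod_erase _ _ (Finset.mem_erase.2
      ⟨by simp, Finset.mem_univ (⟨i + 1, h⟩ : Fin n)⟩), ← mul_assoc]
  simp only [if_true, Nat.succ_ne_self, if_false]
  congr 1
  refine Finset.prod_congr ?_ fun j hj => ?_
  · ext j; simp [Fin.ext_iff]; tauto
  · have hj := Finset.mem_erase.1 hj
    have hj2 := Finset.ne_of_mem_erase hj.2
    rw [if_neg fun h => hj2 (Fin.ext h), if_neg fun h => hj.1 (Fin.ext h)]

theorem tensorPow_eq_bondOp {n i : ℕ} (h : i + 1 < n) (P : Matrix σ σ ℂ) :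
    tensorPow n P = bondOp n i (P ⊗ₖ P) P := by
  rw [bondOp_kronecker h, tensorPow_eq_piOp]
  simp

theorem bondOp_kronecker_one {n i : ℕ} (h : i + 1 < n) (A : Matrix σ σ ℂ) :
    bondOp n i (A ⊗ₖ 1) 1 = siteOp n ⟨i, by omega⟩ A := by
  rw [bondOp_kronecker h, siteOp_eq_piOp]
  simp [Fin.ext_iff]

theorem bondOp_one_kronecker {n i : ℕ} (h : i + 1 < n) (A : Matrix σ σ ℂ) :
    bondOp n i (1 ⊗ₖ A) 1 = siteOp n ⟨i + 1, h⟩ A := by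
  rw [bondOp_kronecker h, siteOp_eq_piOp]
  congr 1
  ext1 j
  by_cases h1 : j.val = i
  · simp [h1, Fin.ext_iff]
  · simp [h1, Fin.ext_iff]

/-- `K ↦ I ⊗ K ⊗ I` with `K` acting on positions `i`, `i + 1`. -/
def bondHom (σ : Type*) [Fintype σ] [DecidableEq σ] {n i : ℕ} (h : i + 1 < n) :
    Matrix (σ × σ) (σ × σ) ℂ →⋆ₙₐ[ℂ] Matrix (Fin n → σ) (Fin n → σ) ℂ :=
  embedHom (pairEquiv σ h) (IsStarProjection.one _)

theorem bondHom_apply {n i : ℕ} (h : i + 1 < n) (K : Matrix (σ × σ) (σ × σ) ℂ) :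
    bondHom σ h K = bondOp n i K 1 := by
  rw [bondOp_eq_submatrix h, bondHom, embedHom_apply]
  congr 2
  exact piOp_one.symm

theorem bondOp_mono {n i : ℕ} (h : i + 1 < n) {K K' : Matrix (σ × σ) (σ × σ) ℂ} (hK : K ≤ K') :
    bondOp n i K 1 ≤ bondOp n i K' 1 := by
  rw [← bondHom_apply h, ← bondHom_apply h]; exact embedHom_mono _ _ hK

theorem bondOp_one_nonneg (n i : ℕ) {K : Matrix (σ × σ) (σ × σ) ℂ} (hK : 0 ≤ K) :
    0 ≤ bondOp n i K (1 : Matrix σ σ ℂ) := by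
  by_cases h : i + 1 < n
  · rw [← bondHom_apply h]; exact embedHom_nonneg _ _ hK
  · have : bondOp n i K (1 : Matrix σ σ ℂ) = 0 := by
      ext x y
      rw [bondOp, dif_neg h]; rfl
    rw [this]

theorem bondOp_nonneg {n i : ℕ} (h : i + 1 < n) {K : Matrix (σ × σ) (σ × σ) ℂ} (hK : 0 ≤ K)
    {P : Matrix σ σ ℂ} (hP : IsStarProjection P) : 0 ≤ bondOp n i K P := by
  rw [bondOp_eq_submatrix h]
  exact embedHom_nonneg (pairEquiv σ h) (isStarProjection_piOp fun _ => hP) hK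

theorem commute_bondOp_one {n s t : ℕ} (hst : s + 1 < t) (ht : t + 1 < n)
    (K K' : Matrix (σ × σ) (σ × σ) ℂ) :
    Commute (bondOp n s K (1 : Matrix σ σ ℂ)) (bondOp n t K' 1) := by
  have hs : s + 1 < n := by omega
  rw [← bondHom_apply hs, ← bondHom_apply ht]
  -- By bilinearity it suffices to treat matrix units, which are product operators; commutation can
  -- then be checked site by site.
  induction K using Matrix.induction_on' with
  | h_zero => rw [map_zero]; exact Commute.zero_left _
  | h_add A B hA hB => rw [map_add]; exact hA.add_left hB
  | h_std_basis a b x =>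
    induction K' using Matrix.induction_on' with
    | h_zero => rw [map_zero]; exact Commute.zero_right _
    | h_add A B hA hB => rw [map_add]; exact hA.add_right hB
    | h_std_basis c d y =>
      have h1 (a b : σ × σ) (x : ℂ) : Matrix.single a b x =
          Matrix.single a.1 b.1 x ⊗ₖ Matrix.single a.2 b.2 1 := by
        rw [Matrix.single_kronecker_single, mul_one]
      rw [bondHom_apply, bondHom_apply, h1 a, h1 c, bondOp_kronecker hs, bondOp_kronecker ht]
      refine commute_piOp fun j => ?_
      split_ifs <;> first | omega | simp

end Bonds

/-! ### Sums of bond operators -/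

section General

variable {m : Type*} [Fintype m] [DecidableEq m]

theorem mulVec_eq_zero_of_le {A B : Matrix m m ℂ} {v : m → ℂ} (hA : 0 ≤ A) (hAB : A ≤ B)
    (h : B *ᵥ v = 0) : A *ᵥ v = 0 := by
  have hA' : A.PosSemidef := Matrix.nonneg_iff_posSemidef.1 hA
  rw [← hA'.dotProduct_mulVec_zero_iff]
  have h1 := star_dotProduct_mulVec_mono hAB v
  rw [h, dotProduct_zero] at h1
  have h2 := hA'.dotProduct_mulVec_nonneg v
  rw [Complex.le_def] at h2
  exact Complex.ext (le_antisymm h1 h2.1) h2.2.symm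

theorem norm_submatrix_equiv_le {X : Type*} [Fintype X] [DecidableEq X] (e : X ≃ m)
    (A : Matrix m m ℂ) : ‖A.submatrix e e‖ ≤ ‖A‖ := by
  have h := norm_embedHom_le (e.trans (Equiv.prodPUnit.{0} m).symm)
    (IsStarProjection.one (Matrix PUnit.{1} PUnit.{1} ℂ)) A
  have h2 : embedHom (e.trans (Equiv.prodPUnit.{0} m).symm)
      (IsStarProjection.one (Matrix PUnit.{1} PUnit.{1} ℂ)) A = A.submatrix e e := by
    ext x y
    simp [embedHom_apply]
  rwa [h2] at h

theorem IsStarProjection.kronecker {α β : Type*} [Fintype α] [DecidableEq α] [Fintype β]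
    [DecidableEq β] {P : Matrix α α ℂ} {Q : Matrix β β ℂ} (hP : IsStarProjection P)
    (hQ : IsStarProjection Q) : IsStarProjection (P ⊗ₖ Q) := by
  refine ⟨?_, ?_⟩
  · rw [IsIdempotentElem, ← Matrix.mul_kronecker_mul, hP.isIdempotentElem.eq, hQ.isIdempotentElem.eq]
  · have h1 : Pᴴ = P := hP.isSelfAdjoint
    have h2 : Qᴴ = Q := hQ.isSelfAdjoint
    rw [IsSelfAdjoint, Matrix.star_eq_conjTranspose, Matrix.conjTranspose_kronecker, h1, h2]

variable {σ : Type*} [Fintype σ] [DecidableEq σ]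

theorem norm_leftOp_le (K : Matrix (σ × σ) (σ × σ) ℂ) {P : Matrix σ σ ℂ} (hP : IsStarProjection P) :
    ‖leftOp K P‖ ≤ ‖K‖ :=
  norm_embedHom_le (Equiv.prodAssoc σ σ σ).symm hP K

theorem leftOp_nonneg {K : Matrix (σ × σ) (σ × σ) ℂ} (hK : 0 ≤ K) {P : Matrix σ σ ℂ}
    (hP : IsStarProjection P) : 0 ≤ leftOp K P :=
  embedHom_nonneg (Equiv.prodAssoc σ σ σ).symm hP hK

theorem leftOp_sub (K K' : Matrix (σ × σ) (σ × σ) ℂ) {P : Matrix σ σ ℂ} (hP : IsStarProjection P) :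
    leftOp K P - leftOp K' P = leftOp (K - K') P :=
  (map_sub (embedHom (Equiv.prodAssoc σ σ σ).symm hP) K K').symm

theorem rightOp_eq_embedHom (K : Matrix (σ × σ) (σ × σ) ℂ) {P : Matrix σ σ ℂ}
    (hP : IsStarProjection P) : rightOp K P = embedHom (Equiv.prodComm σ (σ × σ)) hP K := by
  ext x y
  simp [rightOp, embedHom_apply, mul_comm]

theorem norm_rightOp_le (K : Matrix (σ × σ) (σ × σ) ℂ) {P : Matrix σ σ ℂ}
    (hP : IsStarProjection P) : ‖rightOp K P‖ ≤ ‖K‖ := by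
  rw [rightOp_eq_embedHom K hP]; exact norm_embedHom_le _ hP K

theorem rightOp_nonneg {K : Matrix (σ × σ) (σ × σ) ℂ} (hK : 0 ≤ K) {P : Matrix σ σ ℂ}
    (hP : IsStarProjection P) : 0 ≤ rightOp K P := by
  rw [rightOp_eq_embedHom K hP]; exact embedHom_nonneg _ hP hK

theorem rightOp_sub (K K' : Matrix (σ × σ) (σ × σ) ℂ) {P : Matrix σ σ ℂ}
    (hP : IsStarProjection P) : rightOp K P - rightOp K' P = rightOp (K - K') P := by
  simp only [rightOp_eq_embedHom _ hP, map_sub]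

/-- The gap inequality for a sum of bond operators, from the inequalities for one and two bonds. -/
theorem smul_sum_bondOp_le {K : Matrix (σ × σ) (σ × σ) ℂ} {P : Matrix σ σ ℂ} {γ ε : ℝ}
    (hP : IsStarProjection P) (hK : 0 ≤ K) (hKP : K * (P ⊗ₖ P) = K) (hε : 0 ≤ ε)
    (hγ : γ • K ≤ K * K)
    (hanti : -(ε • (leftOp K P + rightOp K P)) ≤
      leftOp K P * rightOp K P + rightOp K P * leftOp K P) (n : ℕ) :
    (γ - 2 * ε) • ∑ s ∈ Finset.range (n - 1), bondOp n s K P ≤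
      (∑ s ∈ Finset.range (n - 1), bondOp n s K P) *
        ∑ s ∈ Finset.range (n - 1), bondOp n s K P := by
  have hPK : (P ⊗ₖ P) * K = K := by
    have := congrArg star hKP
    rwa [star_mul, (IsSelfAdjoint.of_nonneg hK).star_eq, (hP.kronecker hP).isSelfAdjoint.star_eq]
      at this
  refine smul_sum_le_sum_mul_sum hε ?_ ?_ ?_ ?_
  · intro s hs
    exact bondOp_nonneg (by omega) hK hP
  · intro s hs
    have hs : s + 1 < n := by omega
    have hR := isStarProjection_piOp (ι := {j : Fin n // j.val ≠ s ∧ j.val ≠ s + 1}) fun _ => hP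
    have h := embedHom_mono (pairEquiv σ hs) hR hγ
    rw [map_mul, ← Complex.coe_smul γ K, map_smul, Complex.coe_smul] at h
    simpa only [bondOp_eq_submatrix hs, embedHom_apply] using h
  · intro s t hst ht
    have hs : s + 1 < n := by omega
    have ht : t + 1 < n := by omega
    -- Spectator projectors are separated off as a global `P^{⊗ n}`, which commutes with the bonds;
    -- distant bonds then commute by disjointness of supports.
    have hT (i) (hi : i + 1 < n) : bondOp n i K P = bondOp n i K 1 * tensorPow n P := by
      rw [tensorPow_eq_bondOp hi, bondOp_mul hi, hKP, one_mul]
    have hc (i) (hi : i + 1 < n) : Commute (bondOp n i K 1) (tensorPow n P) := by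
      rw [Commute, SemiconjBy, tensorPow_eq_bondOp hi, bondOp_mul hi, bondOp_mul hi, hKP, hPK,
        one_mul, mul_one]
    rw [hT s hs, hT t ht]
    exact ((commute_bondOp_one hst ht K K).mul_right (hc s hs)).mul_left
      ((hc t ht).symm.mul_right (Commute.refl _))
  · intro s hs
    have hs : s + 2 < n := by omega
    have hR := isStarProjection_piOp
      (ι := {j : Fin n // j.val ≠ s ∧ j.val ≠ s + 1 ∧ j.val ≠ s + 2}) fun _ => hP
    have h := embedHom_mono (tripleEquiv σ hs) hR hanti
    rw [map_neg, ← Complex.coe_smul ε, map_smul, Complex.coe_smul, map_add, map_add, map_mul,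
      map_mul] at h
    simpa only [bondOp_eq_left hs, bondOp_eq_right hs, embedHom_apply] using h

theorem bondOp_one_apply {n i : ℕ} (h : i + 1 < n) (K : Matrix (σ × σ) (σ × σ) ℂ)
    {a b : Fin n} (ha : a.val = i) (hb : b.val = i + 1) (x y : Fin n → σ) :
    bondOp n i K 1 x y =
      if ∀ j, j ≠ a → j ≠ b → x j = y j then K (x a, x b) (y a, y b) else 0 := by
  subst ha
  obtain rfl : b = ⟨a.val + 1, h⟩ := Fin.ext hb
  rw [bondOp, dif_pos h]
  simp only [Matrix.one_apply, Finset.prod_boole, mul_ite, mul_one, mul_zero]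
  refine if_congr ?_ rfl rfl
  simp [Fin.ext_iff]

theorem siteOp_apply (n : ℕ) (i : Fin n) (A : Matrix σ σ ℂ) (x y : Fin n → σ) :
    siteOp n i A x y = if ∀ j, j ≠ i → x j = y j then A (x i) (y i) else 0 := by
  rw [siteOp]
  simp only [Matrix.one_apply, Finset.prod_boole, mul_ite, mul_one, mul_zero]
  refine if_congr ?_ rfl rfl
  simp

end General

/-! ### Segments as blocks of one long chain -/

section Blocks

variable {d : ℕ}

/-- A configuration of `n` segments of length `l` as a configuration of one chain. -/
def flatten (d n l : ℕ) : (Fin n → Seg d l) ≃ Seg d (n * l) :=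
  (Equiv.curry (Fin n) (Fin l) (Fin d)).symm.trans
    (Equiv.arrowCongr finProdFinEquiv (Equiv.refl (Fin d)))

theorem flatten_apply (n l : ℕ) (x : Fin n → Seg d l) (s : Fin n) (i : Fin l) :
    flatten d n l x (finProdFinEquiv (s, i)) = x s i := by
  simp [flatten]

theorem siteOp_bondOp_eq (n l : ℕ) (s : Fin n) (i : ℕ) (hi : i + 1 < l)
    (K : Matrix (Fin d × Fin d) (Fin d × Fin d) ℂ) :
    siteOp n s (bondOp l i K 1) =
      (bondOp (n * l) (i + l * s) K 1).submatrix (flatten d n l) (flatten d n l) := by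
  ext x y
  let a : Fin l := ⟨i, by omega⟩
  let b : Fin l := ⟨i + 1, hi⟩
  have hb : (finProdFinEquiv (s, b)).val = i + l * s + 1 := by simp [b]; ring
  rw [siteOp_apply, bondOp_one_apply hi K (a := a) (b := b) rfl rfl, Matrix.submatrix_apply,
    bondOp_one_apply (i := i + l * s) (by rw [← hb]; exact Fin.is_lt _) K
      (a := finProdFinEquiv (s, a))
      (b := finProdFinEquiv (s, b)) rfl hb]
  simp only [flatten_apply]
  rw [← ite_and]
  refine if_congr ?_ rfl rfl
  rw [← finProdFinEquiv.forall_congr_right]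
  simp only [Prod.forall, flatten_apply, ne_eq, EmbeddingLike.apply_eq_iff_eq, Prod.mk.injEq]
  constructor
  · rintro ⟨h1, h2⟩ t j ha hb
    by_cases hts : t = s
    · subst hts
      exact h2 j (fun h => ha ⟨rfl, h⟩) (fun h => hb ⟨rfl, h⟩)
    · rw [h1 t hts]
  · intro h
    exact ⟨fun t ht => funext fun j => h t j (fun h => ht h.1) (fun h => ht h.1),
      fun j ha hb => h s j (fun h => ha h.2) (fun h => hb h.2)⟩

theorem bondOp_linkOp_eq (n l : ℕ) (hl : 1 ≤ l) (s : ℕ) (hs : s + 1 < n)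
    (K : Matrix (Fin d × Fin d) (Fin d × Fin d) ℂ) :
    bondOp n s (linkOp K l) 1 =
      (bondOp (n * l) (l - 1 + l * s) K 1).submatrix (flatten d n l) (flatten d n l) := by
  ext x y
  let s0 : Fin n := ⟨s, by omega⟩
  let s1 : Fin n := ⟨s + 1, hs⟩
  let a : Fin l := ⟨l - 1, by omega⟩
  let b : Fin l := ⟨0, by omega⟩
  have hb : (finProdFinEquiv (s1, b)).val = l - 1 + l * s + 1 := by
    simp [b, s1]
    rw [mul_add, mul_one]; omega
  have hs01 : s0 ≠ s1 := by simp [s0, s1]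
  rw [bondOp_one_apply hs _ (a := s0) (b := s1) rfl rfl, linkOp, Matrix.submatrix_apply,
    bondOp_one_apply (i := l - 1) (by omega) K (a := Fin.castAdd l a) (b := Fin.natAdd l b) rfl
      (by simp [b]; omega), Matrix.submatrix_apply,
    bondOp_one_apply (i := l - 1 + l * s) (by rw [← hb]; exact Fin.is_lt _) K
      (a := finProdFinEquiv (s0, a))
      (b := finProdFinEquiv (s1, b)) rfl hb]
  simp only [flatten_apply, Fin.append_left, Fin.append_right]
  rw [← ite_and]
  refine if_congr ?_ rfl rfl
  rw [← finProdFinEquiv.forall_congr_right]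
  simp only [Prod.forall, flatten_apply, ne_eq, EmbeddingLike.apply_eq_iff_eq, Prod.mk.injEq]
  constructor
  · rintro ⟨h1, h2⟩ t j ha hb
    by_cases ht0 : t = s0
    · subst ht0
      have := h2 (Fin.castAdd l j) (fun h => ha ⟨rfl, by simpa using h⟩)
        (fun h => by have := congrArg Fin.val h; simp at this; omega)
      simpa using this
    · by_cases ht1 : t = s1
      · subst ht1
        have := h2 (Fin.natAdd l j)
          (fun h => by have := congrArg Fin.val h; simp at this; omega)
          (fun h => hb ⟨rfl, by simpa using h⟩)
        rwa [Fin.append_right, Fin.append_right] at this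
      · rw [h1 t ht0 ht1]
  · intro h
    refine ⟨fun t h0 h1 => funext fun j => h t j (fun h => h0 h.1) (fun h => h1 h.1), fun j => ?_⟩
    refine Fin.addCases (fun j => ?_) (fun j => ?_) j
    · intro ha _
      simpa using h s0 j (fun h => ha (by rw [h.2])) (fun h => hs01 h.1)
    · intro _ hb
      rw [Fin.append_right, Fin.append_right]
      exact h s1 j (fun h => hs01 h.1.symm) (fun h => hb (by rw [h.2]))

variable {Hb : Matrix (Fin d × Fin d) (Fin d × Fin d) ℂ}

/-- After flattening, segment terms and links are all bonds of one chain of `n * l` spins. Its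
zero-energy state is annihilated by each bond separately, since the bonds are positive. -/
theorem FrustrationFree.exists_ham_mulVec_eq_zero (hff : FrustrationFree Hb) (hHb : 0 ≤ Hb) {l : ℕ}
    (hl : 1 ≤ l) (n : ℕ) : ∃ v : (Fin n → Seg d l) → ℂ, v ≠ 0 ∧ ham Hb l n *ᵥ v = 0 := by
  obtain ⟨v, hv, h⟩ := hff (n * l)
  have hbond (k : ℕ) (hk : k + 1 < n * l) : bondOp (n * l) k Hb 1 *ᵥ v = 0 := by
    refine mulVec_eq_zero_of_le (bondOp_one_nonneg _ _ hHb) ?_ h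
    exact Finset.single_le_sum (f := fun i => bondOp (n * l) i Hb 1)
      (fun i _ => bondOp_one_nonneg _ _ hHb) (Finset.mem_range.2 (by omega))
  have hsub (k : ℕ) (hk : k + 1 < n * l) :
      (bondOp (n * l) k Hb 1).submatrix (flatten d n l) (flatten d n l) *ᵥ (v ∘ flatten d n l) = 0 := by
    rw [Matrix.submatrix_mulVec_equiv]
    have : (v ∘ flatten d n l) ∘ (flatten d n l).symm = v := by ext; simp
    rw [this, hbond k hk]
    rfl
  refine ⟨v ∘ flatten d n l, fun h0 => hv ?_, ?_⟩
  · ext x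
    simpa using congrFun h0 ((flatten d n l).symm x)
  · rw [ham, Matrix.add_mulVec, hamS, hamL, Matrix.sum_mulVec, Matrix.sum_mulVec]
    rw [Finset.sum_eq_zero, Finset.sum_eq_zero, add_zero]
    · intro s hs
      have hs : s + 1 < n := by have := Finset.mem_range.1 hs; omega
      rw [bondOp_linkOp_eq n l hl s hs, hsub]
      have : l * (s + 2) ≤ l * n := Nat.mul_le_mul_left l hs
      rw [mul_comm n l]
      rw [mul_add] at this
      omega
    · intro s _
      have h1 : siteOp n s (segHam Hb l) = ∑ i ∈ Finset.range (l - 1), siteOp n s (bondOp l i Hb 1) := by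
        rw [segHam, ← siteHom_apply, map_sum]
        simp only [siteHom_apply]
      rw [h1, Matrix.sum_mulVec]
      refine Finset.sum_eq_zero fun i hi => ?_
      have hi : i + 1 < l := by have := Finset.mem_range.1 hi; omega
      rw [siteOp_bondOp_eq n l s i hi, hsub]
      have : l * (s.val + 1) ≤ l * n := Nat.mul_le_mul_left l s.isLt
      rw [mul_comm n l]
      rw [mul_add] at this
      omega

end Blocks

/-! ### Comparing the full and the renormalized Hamiltonian -/

section Hamiltonians

variable {d : ℕ} {Hb : Matrix (Fin d × Fin d) (Fin d × Fin d) ℂ}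

theorem isStarProjection_segProj (l : ℕ) : IsStarProjection (segProj Hb l) :=
  isStarProjection_kerProj _

theorem segHam_nonneg (hHb : 0 ≤ Hb) (l : ℕ) : 0 ≤ segHam Hb l :=
  Finset.sum_nonneg fun i _ => bondOp_one_nonneg l i hHb

theorem linkOp_nonneg (hHb : 0 ≤ Hb) (l : ℕ) : 0 ≤ linkOp Hb l :=
  Matrix.nonneg_iff_posSemidef.2
    ((Matrix.nonneg_iff_posSemidef.1 (bondOp_one_nonneg (l + l) (l - 1) hHb)).submatrix _)

theorem norm_linkOp_le (Hb : Matrix (Fin d × Fin d) (Fin d × Fin d) ℂ) {l : ℕ} (hl : 1 ≤ l) :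
    ‖linkOp Hb l‖ ≤ ‖Hb‖ := by
  have h1 : linkOp Hb l = (bondOp (l + l) (l - 1) Hb 1).submatrix (Fin.appendEquiv l l)
      (Fin.appendEquiv l l) := rfl
  rw [h1]
  refine (norm_submatrix_equiv_le _ _).trans ?_
  rw [← bondHom_apply (show l - 1 + 1 < l + l by omega)]
  exact norm_embedHom_le _ _ _

theorem hBar_nonneg (hHb : 0 ≤ Hb) (l : ℕ) : 0 ≤ hBar Hb l := by
  have hp := (isStarProjection_segProj (Hb := Hb) l).kronecker (isStarProjection_segProj (Hb := Hb) l)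
  have h := star_left_conjugate_nonneg (linkOp_nonneg hHb l) (segProj Hb l ⊗ₖ segProj Hb l)
  rwa [hp.isSelfAdjoint.star_eq] at h

theorem norm_hBar_le (Hb : Matrix (Fin d × Fin d) (Fin d × Fin d) ℂ) {l : ℕ} (hl : 1 ≤ l) :
    ‖hBar Hb l‖ ≤ ‖Hb‖ := by
  have hp := (isStarProjection_segProj (Hb := Hb) l).kronecker (isStarProjection_segProj (Hb := Hb) l)
  have h := norm_mul_le_of_le (norm_mul_le_of_le hp.norm_le (norm_linkOp_le Hb hl)) hp.norm_le
  simpa [hBar] using h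

theorem hBar_mul_segProj (l : ℕ) : hBar Hb l * (segProj Hb l ⊗ₖ segProj Hb l) = hBar Hb l := by
  have hp := (isStarProjection_segProj (Hb := Hb) l).kronecker (isStarProjection_segProj (Hb := Hb) l)
  rw [hBar, mul_assoc, hp.isIdempotentElem.eq]

theorem renHam_eq_sum (l n : ℕ) :
    renHam Hb l n = ∑ s ∈ Finset.range (n - 1), bondOp n s (hBar Hb l) (segProj Hb l) := by
  rw [renHam, hamL, Finset.mul_sum, Finset.sum_mul]
  refine Finset.sum_congr rfl fun s hs => ?_
  have hs : s + 1 < n := by have := Finset.mem_range.1 hs; omega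
  rw [tensorPow_eq_bondOp hs, bondOp_mul hs, bondOp_mul hs, mul_one,
    (isStarProjection_segProj l).isIdempotentElem.eq, hBar]

theorem hamS_nonneg (hHb : 0 ≤ Hb) (l n : ℕ) : 0 ≤ hamS Hb l n :=
  Finset.sum_nonneg fun s _ => siteOp_nonneg n s (segHam_nonneg hHb l)

theorem hamL_nonneg (hHb : 0 ≤ Hb) (l n : ℕ) : 0 ≤ hamL Hb l n :=
  Finset.sum_nonneg fun s _ => bondOp_one_nonneg n s (linkOp_nonneg hHb l)

theorem ham_nonneg (hHb : 0 ≤ Hb) (l n : ℕ) : 0 ≤ ham Hb l n :=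
  add_nonneg (hamS_nonneg hHb l n) (hamL_nonneg hHb l n)

theorem renHam_nonneg (hHb : 0 ≤ Hb) (l n : ℕ) : 0 ≤ renHam Hb l n := by
  have h := star_left_conjugate_nonneg (hamL_nonneg hHb l n) (tensorPow n (segProj Hb l))
  rwa [(isStarProjection_tensorPow n (isStarProjection_segProj l)).isSelfAdjoint.star_eq] at h

/-- With `T = 1 - p`, the parallelogram identity `(1-T)L(1-T) + (1+T)L(1+T) = 2L + 2TLT` bounds
`pLp`, and `TLT ≤ ‖L‖ T`. -/
theorem IsStarProjection.conjugate_le {m : Type*} [Fintype m] [DecidableEq m] {p L : Matrix m m ℂ}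
    (hp : IsStarProjection p) (hL : 0 ≤ L) :
    p * L * p ≤ (2 : ℝ) • L + (2 * ‖L‖) • (1 - p) := by
  have hT := hp.one_sub
  have h1 : (1 - p) * L * (1 - p) ≤ ‖L‖ • (1 - p) := by
    have h := star_left_conjugate_le_conjugate
      (IsSelfAdjoint.of_nonneg hL).le_algebraMap_norm_self (1 - p)
    rw [hT.isSelfAdjoint.star_eq, Algebra.algebraMap_eq_smul_one] at h
    simpa only [mul_smul_comm, smul_mul_assoc, mul_one, hT.isIdempotentElem.eq] using h
  have h2 : 0 ≤ (2 - p) * L * (2 - p) := by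
    have hs : star (2 - p) = 2 - p := by
      rw [star_sub, hp.isSelfAdjoint.star_eq, star_ofNat]
    have h := star_left_conjugate_nonneg hL (2 - p)
    rwa [hs] at h
  have h3 : (2 : ℝ) • L + (2 : ℝ) • ((1 - p) * L * (1 - p)) - p * L * p =
      (2 - p) * L * (2 - p) := by
    simp only [two_smul]
    noncomm_ring
  have h4 : p * L * p ≤ (2 : ℝ) • L + (2 : ℝ) • ((1 - p) * L * (1 - p)) := by
    rw [← sub_nonneg, h3]; exact h2
  refine h4.trans (add_le_add_right ?_ _)
  rw [mul_smul]
  exact smul_le_smul_of_nonneg_left h1 zero_le_two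

/-- The difference of the two sides is `(1 - P) ⊗ (1 - P)`. -/
theorem one_sub_kronecker_le {σ : Type*} [Fintype σ] [DecidableEq σ] {P : Matrix σ σ ℂ}
    (hP : IsStarProjection P) : 1 - P ⊗ₖ P ≤ (1 - P) ⊗ₖ 1 + 1 ⊗ₖ (1 - P) := by
  have h : 0 ≤ (1 - P) ⊗ₖ (1 - P) := (hP.one_sub.kronecker hP.one_sub).nonneg
  rw [← sub_nonneg]
  convert h using 1
  ext ⟨a, b⟩ ⟨c, e⟩
  simp only [Matrix.sub_apply, Matrix.add_apply, Matrix.kroneckerMap_apply, Matrix.one_apply,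
    Prod.mk.injEq]
  by_cases h1 : a = c <;> by_cases h2 : b = e <;> simp [h1, h2] <;> ring

theorem renHam_le (hHb : 0 ≤ Hb) (l n : ℕ) : renHam Hb l n ≤ (2 : ℝ) • hamL Hb l n +
    (4 * ‖linkOp Hb l‖) • ∑ s : Fin n, siteOp n s (1 - segProj Hb l) := by
  set P := segProj Hb l with hPdef
  have hP : IsStarProjection P := isStarProjection_segProj l
  set c := ‖linkOp Hb l‖ with hc
  have hc0 : 0 ≤ c := norm_nonneg _
  -- Extension by zero lets the site terms be summed over the same natural-number index as the
  -- bonds.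
  let f : ℕ → Matrix (Fin n → Seg d l) (Fin n → Seg d l) ℂ := fun j =>
    if h : j < n then siteOp n ⟨j, h⟩ (1 - P) else 0
  have hf0 (j) : 0 ≤ f j := by
    simp only [f]
    split_ifs
    exacts [siteOp_nonneg _ _ hP.one_sub.nonneg, le_rfl]
  have hfsum : ∑ j ∈ Finset.range n, f j = ∑ s : Fin n, siteOp n s (1 - P) := by
    rw [← Fin.sum_univ_eq_sum_range]
    exact Finset.sum_congr rfl fun s _ => by simp [f]
  have hbond (s) (hs : s + 1 < n) : bondOp n s (hBar Hb l) P ≤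
      (2 : ℝ) • bondOp n s (linkOp Hb l) 1 + (2 * c) • (f s + f (s + 1)) := by
    have h1 : bondOp n s (hBar Hb l) P ≤ bondOp n s (hBar Hb l) 1 := by
      have hT : bondOp n s (hBar Hb l) P = bondOp n s (hBar Hb l) 1 * tensorPow n P := by
        rw [tensorPow_eq_bondOp hs, bondOp_mul hs, hBar_mul_segProj, one_mul]
      have hT' : bondOp n s (hBar Hb l) P = tensorPow n P * bondOp n s (hBar Hb l) 1 := by
        have h := congrArg star hT
        rwa [star_mul, (IsSelfAdjoint.of_nonneg (bondOp_nonneg hs (hBar_nonneg hHb l) hP)).star_eq,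
          (isStarProjection_tensorPow n hP).isSelfAdjoint.star_eq,
          (IsSelfAdjoint.of_nonneg (bondOp_one_nonneg n s (hBar_nonneg hHb l))).star_eq] at h
      have hcomm : Commute (bondOp n s (hBar Hb l) 1) (1 - tensorPow n P) :=
        (Commute.one_right _).sub_right (hT.symm.trans hT')
      have h := hcomm.mul_nonneg (bondOp_one_nonneg n s (hBar_nonneg hHb l))
        (isStarProjection_tensorPow n hP).one_sub.nonneg
      rwa [mul_sub, mul_one, ← hT, sub_nonneg] at h
    have h2 : hBar Hb l ≤ (2 : ℝ) • linkOp Hb l + (2 * c) • ((1 - P) ⊗ₖ 1 + 1 ⊗ₖ (1 - P)) :=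
      ((hP.kronecker hP).conjugate_le (linkOp_nonneg hHb l)).trans
        (add_le_add_right (smul_le_smul_of_nonneg_left (one_sub_kronecker_le hP) (by positivity)) _)
    refine h1.trans ((bondOp_mono hs h2).trans (le_of_eq ?_))
    rw [← bondHom_apply hs, ← Complex.coe_smul 2, ← Complex.coe_smul (2 * c), map_add, map_smul,
      map_smul, map_add, Complex.coe_smul, Complex.coe_smul, bondHom_apply, bondHom_apply,
      bondHom_apply, bondOp_kronecker_one hs, bondOp_one_kronecker hs]
    simp only [f]
    rw [dif_pos hs, dif_pos (show s < n by omega)]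
  rw [renHam_eq_sum]
  refine (Finset.sum_le_sum fun s hs => hbond s (by have := Finset.mem_range.1 hs; omega)).trans ?_
  rw [Finset.sum_add_distrib, ← Finset.smul_sum, ← Finset.smul_sum, Finset.sum_add_distrib, hamL,
    ← hfsum]
  refine add_le_add_right ?_ _
  -- Each site belongs to at most two bonds, which doubles the constant `2 * c`.
  rw [show 4 * c = 2 * c * 2 by ring, mul_smul (2 * c)]
  refine smul_le_smul_of_nonneg_left ?_ (by positivity)
  rw [two_smul]
  refine add_le_add ?_ ?_
  · exact Finset.sum_le_sum_of_subset_of_nonneg (Finset.range_mono (Nat.sub_le n 1))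
      fun i _ _ => hf0 i
  · rcases n with _ | n
    · simp
    · rw [Finset.sum_range_succ', Nat.add_sub_cancel]
      exact le_add_of_nonneg_right (hf0 0)

/-- `H` dominates `(1 - P^S) + h` up to a constant that does not depend on the system size. -/
theorem exists_le_smul_ham (hHb : 0 ≤ Hb) (l : ℕ) : ∃ C : ℝ, 0 < C ∧ ∀ n,
    1 - tensorPow n (segProj Hb l) + renHam Hb l n ≤ C • ham Hb l n := by
  obtain ⟨g, hg, hgS⟩ := exists_pos_smul_le_mul_self (segHam_nonneg hHb l)
  have hP : IsStarProjection (segProj Hb l) := isStarProjection_segProj l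
  have h1 : 1 - segProj Hb l ≤ g⁻¹ • segHam Hb l := by
    have h := smul_le_smul_of_nonneg_left
      (smul_one_sub_kerProj_le (segHam_nonneg hHb l) hgS) (inv_nonneg.2 hg.le)
    rwa [smul_smul, inv_mul_cancel₀ hg.ne', one_smul] at h
  set c := ‖linkOp Hb l‖
  have hc0 : 0 ≤ c := norm_nonneg _
  -- The sum of the coefficient `2` of `H^L` and the coefficient `(1 + 4c) / g` of `H^S`, where `g`
  -- bounds the gap of one segment; `n` does not enter.
  refine ⟨2 + (1 + 4 * c) * g⁻¹, by positivity, fun n => ?_⟩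
  set E := ∑ s : Fin n, siteOp n s (1 - segProj Hb l) with hE
  have h2 : E ≤ g⁻¹ • hamS Hb l n := by
    rw [hE, hamS, Finset.smul_sum]
    refine Finset.sum_le_sum fun s _ => ?_
    rw [← siteOp_smul]
    exact siteOp_mono _ _ h1
  have hS := hamS_nonneg hHb l n
  have hL := hamL_nonneg hHb l n
  calc 1 - tensorPow n (segProj Hb l) + renHam Hb l n
      ≤ E + ((2 : ℝ) • hamL Hb l n + (4 * c) • E) :=
        add_le_add (one_sub_tensorPow_le n hP) (renHam_le hHb l n)
    _ = (2 : ℝ) • hamL Hb l n + (1 + 4 * c) • E := by module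
    _ ≤ (2 : ℝ) • hamL Hb l n + (1 + 4 * c) • (g⁻¹ • hamS Hb l n) :=
        add_le_add_right (smul_le_smul_of_nonneg_left h2 (by positivity)) _
    _ ≤ ((2 : ℝ) • hamL Hb l n + (1 + 4 * c) • (g⁻¹ • hamS Hb l n)) +
        ((2 : ℝ) • hamS Hb l n + ((1 + 4 * c) * g⁻¹) • hamL Hb l n) :=
        le_add_of_nonneg_right
          (add_nonneg (smul_nonneg zero_le_two hS) (smul_nonneg (by positivity) hL))
    _ = _ := by rw [ham]; module

theorem zero_mem_spectrum_ham (hHb : 0 ≤ Hb) (hff : FrustrationFree Hb) {l : ℕ} (hl : 1 ≤ l)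
    (n : ℕ) : (0 : ℝ) ∈ spectrum ℝ (ham Hb l n) := by
  obtain ⟨v, hv, h⟩ := hff.exists_ham_mulVec_eq_zero hHb hl n
  exact zero_mem_spectrum_of_mulVec_eq_zero hv h

theorem exists_renHam_mulVec_eq_zero (hHb : 0 ≤ Hb) (hff : FrustrationFree Hb) {l : ℕ}
    (hl : 1 ≤ l) (n : ℕ) : ∃ v : (Fin n → Seg d l) → ℂ, v ≠ 0 ∧ renHam Hb l n *ᵥ v = 0 := by
  obtain ⟨v, hv, h⟩ := hff.exists_ham_mulVec_eq_zero hHb hl n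
  obtain ⟨C, -, hle⟩ := exists_le_smul_ham hHb l
  have hP := isStarProjection_tensorPow n (isStarProjection_segProj (Hb := Hb) l)
  refine ⟨v, hv, mulVec_eq_zero_of_le (renHam_nonneg hHb l n)
    ((le_add_of_nonneg_left hP.one_sub.nonneg).trans (hle n)) ?_⟩
  rw [Matrix.smul_mulVec, h, smul_zero]

theorem zero_mem_spectrum_renHam (hHb : 0 ≤ Hb) (hff : FrustrationFree Hb) {l : ℕ} (hl : 1 ≤ l)
    (n : ℕ) : (0 : ℝ) ∈ spectrum ℝ (renHam Hb l n) := by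
  obtain ⟨v, hv, h⟩ := exists_renHam_mulVec_eq_zero hHb hff hl n
  exact zero_mem_spectrum_of_mulVec_eq_zero hv h

theorem zero_mem_spectrum_hBar (hHb : 0 ≤ Hb) (hff : FrustrationFree Hb) {l : ℕ} (hl : 1 ≤ l) :
    (0 : ℝ) ∈ spectrum ℝ (hBar Hb l) := by
  obtain ⟨v, hv, h⟩ := exists_renHam_mulVec_eq_zero hHb hff hl 2
  rw [spectrum.zero_mem_iff]
  rintro ⟨u, hu⟩
  have h2 : (0 : ℕ) + 1 < 2 := by norm_num
  -- With two segments there are no spectators, so `h` is a unital image of `h̄`; invertibility of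
  -- `h̄` would contradict the zero mode of `h`.
  have hbond : renHam Hb l 2 = bondHom (Seg d l) h2 (hBar Hb l) := by
    rw [renHam_eq_sum, bondHom_apply]
    simp only [Nat.add_one_sub_one, Finset.range_one, Finset.sum_singleton]
    ext x y
    have he : (Finset.univ.filter fun j : Fin 2 => j.val ≠ 0 ∧ j.val ≠ 0 + 1) = ∅ := by decide
    rw [bondOp, bondOp, dif_pos h2, dif_pos h2, he, Finset.prod_empty, Finset.prod_empty]
  apply hv
  have hone : bondHom (Seg d l) h2 1 = 1 := embedHom_one_one _
  have hinv : bondHom (Seg d l) h2 (u⁻¹ : (Matrix _ _ ℂ)ˣ) * renHam Hb l 2 = 1 := by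
    rw [hbond, ← map_mul, ← hu, Units.inv_mul, hone]
  rw [← Matrix.one_mulVec v, ← hinv, ← Matrix.mulVec_mulVec, h, Matrix.mulVec_zero]

/-- A uniform gap of `h` yields a uniform gap of `H`. -/
theorem isGapped_ham_of_renHam (hHb : 0 ≤ Hb) (hff : FrustrationFree Hb) {l : ℕ} (hl : 1 ≤ l)
    {γ : ℝ} (hγ : 0 < γ) (h : ∀ n, γ • renHam Hb l n ≤ renHam Hb l n * renHam Hb l n) :
    IsGapped fun n => ham Hb l n := by
  obtain ⟨C, hC, hle⟩ := exists_le_smul_ham hHb l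
  refine ⟨min 1 γ / C, by positivity, fun n => ?_⟩
  refine le_spectralGap (ham_nonneg hHb l n) (zero_mem_spectrum_ham hHb hff hl n) ?_
  have hPseg : IsStarProjection (segProj Hb l) := isStarProjection_segProj l
  set P := tensorPow n (segProj Hb l) with hPdef
  have hP : IsStarProjection P := isStarProjection_tensorPow n hPseg
  set R := renHam Hb l n with hR
  have hR0 : 0 ≤ R := renHam_nonneg hHb l n
  have hT0 : 0 ≤ 1 - P := hP.one_sub.nonneg
  have hTR : (1 - P) * R = 0 := by
    rw [hR, renHam, ← hPdef, ← mul_assoc, ← mul_assoc, sub_mul, one_mul, hP.isIdempotentElem.eq,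
      sub_self, zero_mul, zero_mul]
  have hRT : R * (1 - P) = 0 := by
    rw [hR, renHam, ← hPdef, mul_assoc, mul_sub, mul_one, hP.isIdempotentElem.eq, sub_self, mul_zero]
  refine smul_le_mul_self_of_le_smul hC (ham_nonneg hHb l n) (add_nonneg hT0 hR0) ?_ (hle n) ?_
  · have h1 : (1 - P + R) * (1 - P + R) = (1 - P) + R * R := by
      rw [add_mul, mul_add, mul_add, hTR, hRT, hP.one_sub.isIdempotentElem.eq]; abel
    rw [h1, smul_add]
    refine add_le_add ?_ ?_
    · simpa using smul_le_smul_of_nonneg_right (min_le_left 1 γ) hT0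
    · exact (smul_le_smul_of_nonneg_right (min_le_right 1 γ) hR0).trans (h n)
  · set W := 1 - P + R with hW
    set Q := kerProj W with hQdef
    have hQ : star Q = Q := (isStarProjection_kerProj W).isSelfAdjoint
    have hTQ : (1 - P) * Q = 0 :=
      Matrix.mul_eq_zero_of_le hT0 (le_add_of_nonneg_right hR0) (mul_kerProj W)
    have hRQ : R * Q = 0 :=
      Matrix.mul_eq_zero_of_le hR0 (le_add_of_nonneg_left hT0) (mul_kerProj W)
    have hPQ : P * Q = Q := by
      rw [sub_mul, one_mul, sub_eq_zero] at hTQ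
      exact hTQ.symm
    have hQP : Q * P = Q := by
      have h := congrArg star hPQ
      rwa [star_mul, hQ, hP.isSelfAdjoint.star_eq] at h
    -- On `ker W` the projector `P^S` acts as the identity, so `h Q = 0` says that `H^L` has zero
    -- expectation there; positivity then gives `H^L Q = 0`.
    have hL : hamL Hb l n * Q = 0 := by
      refine Matrix.mul_eq_zero_of_star_mul_mul_eq_zero (hamL_nonneg hHb l n) ?_
      calc star Q * hamL Hb l n * Q = (Q * P) * hamL Hb l n * (P * Q) := by rw [hPQ, hQP, hQ]
        _ = Q * (R * Q) := by rw [hR, renHam, ← hPdef]; simp only [mul_assoc]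
        _ = 0 := by rw [hRQ, mul_zero]
    have hS : hamS Hb l n * Q = 0 := by
      rw [← hPQ, ← mul_assoc, hamS, Finset.sum_mul, Finset.sum_eq_zero, zero_mul]
      exact fun s _ => siteOp_mul_tensorPow n s (mul_kerProj _)
    change (hamS Hb l n + hamL Hb l n) * Q = 0
    rw [add_mul, hS, hL, add_zero]

theorem smul_renHam_le (hHb : 0 ≤ Hb) {l : ℕ} {γ ε : ℝ} (hε : 0 ≤ ε)
    (hγ : γ • hBar Hb l ≤ hBar Hb l * hBar Hb l)
    (hanti : -(ε • (leftOp (hBar Hb l) (segProj Hb l) + rightOp (hBar Hb l) (segProj Hb l))) ≤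
      leftOp (hBar Hb l) (segProj Hb l) * rightOp (hBar Hb l) (segProj Hb l) +
        rightOp (hBar Hb l) (segProj Hb l) * leftOp (hBar Hb l) (segProj Hb l)) (n : ℕ) :
    (γ - 2 * ε) • renHam Hb l n ≤ renHam Hb l n * renHam Hb l n := by
  rw [renHam_eq_sum]
  exact smul_sum_bondOp_le (isStarProjection_segProj l) (hBar_nonneg hHb l) (hBar_mul_segProj l) hε
    hγ hanti n

/-- The gap inequality for `h` in terms of the one for two adjacent segments. -/
theorem smul_renHam_le_of_decomposition (hHb : 0 ≤ Hb) {l : ℕ}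
    {ht : Matrix (Seg d l × Seg d l) (Seg d l × Seg d l) ℂ} (hht : 0 ≤ ht)
    (hcomm : Commute (rightOp ht (segProj Hb l)) (leftOp ht (segProj Hb l))) {γ g Δ η : ℝ}
    (hγ : γ • hBar Hb l ≤ hBar Hb l * hBar Hb l)
    (hg : (g : EReal) ≤ orderedEigenvalue (leftOp ht (segProj Hb l) + rightOp ht (segProj Hb l))
      (kerDim (leftOp (hBar Hb l) (segProj Hb l) + rightOp (hBar Hb l) (segProj Hb l))))
    (hΔ : ‖hBar Hb l - ht‖ ≤ Δ) (hη : ‖ht‖ ≤ η) (hΔg : 2 * Δ < g) (n : ℕ) :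
    (γ - 4 * Δ * (2 * η + Δ) / (g - 2 * Δ)) • renHam Hb l n ≤
      renHam Hb l n * renHam Hb l n := by
  have hP : IsStarProjection (segProj Hb l) := isStarProjection_segProj l
  have hh := hBar_nonneg hHb l
  have hΔ0 : 0 ≤ Δ := (norm_nonneg _).trans hΔ
  have hη0 : 0 ≤ η := (norm_nonneg _).trans hη
  have hμ : 0 < g - 2 * Δ := sub_pos.2 hΔg
  have hA := leftOp_nonneg hh hP
  have hB := rightOp_nonneg hh hP
  have hl : ‖leftOp (hBar Hb l) (segProj Hb l) - leftOp ht (segProj Hb l)‖ ≤ Δ := by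
    rw [leftOp_sub _ _ hP]; exact (norm_leftOp_le _ hP).trans hΔ
  have hr : ‖rightOp (hBar Hb l) (segProj Hb l) - rightOp ht (segProj Hb l)‖ ≤ Δ := by
    rw [rightOp_sub _ _ hP]; exact (norm_rightOp_le _ hP).trans hΔ
  -- Each of the two summands moves by at most `Δ`, hence the perturbation `2 * Δ`.
  have hweyl := smul_le_mul_self_of_orderedEigenvalue (add_nonneg hA hB) (δ := 2 * Δ) (by
    rw [norm_sub_rev, add_sub_add_comm]
    exact (norm_add_le_of_le hl hr).trans_eq (two_mul Δ).symm) hg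
  have hanti := neg_smul_add_le_anticommutator hA hB hμ (by positivity) hweyl
    (neg_smul_one_le_anticommutator (.of_nonneg hA) (.of_nonneg hB) (leftOp_nonneg hht hP)
      (rightOp_nonneg hht hP) hcomm.symm ((norm_leftOp_le _ hP).trans hη)
      ((norm_rightOp_le _ hP).trans hη) hl hr)
  have h := smul_renHam_le hHb (by positivity) hγ hanti n
  convert h using 2
  ring

end Hamiltonians

/-! ### The main theorem -/

theorem theorem2 (d : ℕ) (Hb : Matrix (Fin d × Fin d) (Fin d × Fin d) ℂ)
    (hHb : Hb.PosSemidef) (hff : FrustrationFree Hb)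
    (ht : ∀ l : ℕ, Matrix (Seg d l × Seg d l) (Seg d l × Seg d l) ℂ)
    (hdec : DecayingCorrelations Hb ht)
    (z : ℕ → ℕ)
    (hz : ∀ l : ℕ, 1 ≤ l →
      z l = kerDim (leftOp (hBar Hb l) (segProj Hb l) + rightOp (hBar Hb l) (segProj Hb l)))
    (gt : ℕ → ℝ)
    (hgt : ∀ l : ℕ, 1 ≤ l →
      (gt l : EReal) ≤
        orderedEigenvalue (leftOp (ht l) (segProj Hb l) + rightOp (ht l) (segProj Hb l)) (z l))
    (hgap : ∃ c : ℝ, 0 < c ∧ ∃ L : ℕ, ∀ l : ℕ, L ≤ l →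
      (c : EReal) < spectralGap (hBar Hb l) ∧ c < gt l) :
    (∃ Δ₀ : ℝ, 0 < Δ₀ ∧ (∃ l : ℕ, 1 ≤ l ∧ ‖hBar Hb l - ht l‖ ≤ Δ₀) ∧
      ∀ l : ℕ, 1 ≤ l → ‖hBar Hb l - ht l‖ ≤ Δ₀ → IsGapped (fun n => ham Hb l n)) ∧
    (∀ l : ℕ, 1 ≤ l → ∀ Δ η : ℝ,
      ‖hBar Hb l - ht l‖ ≤ Δ → ‖ht l‖ ≤ η → 2 * Δ < gt l →
      ∀ n : ℕ, spectralGap (hBar Hb l) -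
          ((4 * Δ * (2 * η + Δ) / (gt l - 2 * Δ) : ℝ) : EReal) ≤
        spectralGap (renHam Hb l n)) := by
  have hH0 : 0 ≤ Hb := Matrix.nonneg_iff_posSemidef.2 hHb
  have hdecomp (l : ℕ) (hl : 1 ≤ l) {γ Δ η : ℝ} (hγ : (γ : EReal) ≤ spectralGap (hBar Hb l))
      (hΔ : ‖hBar Hb l - ht l‖ ≤ Δ) (hη : ‖ht l‖ ≤ η) (hΔg : 2 * Δ < gt l) (n : ℕ) :
      (γ - 4 * Δ * (2 * η + Δ) / (gt l - 2 * Δ)) • renHam Hb l n ≤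
        renHam Hb l n * renHam Hb l n :=
    smul_renHam_le_of_decomposition hH0 (Matrix.nonneg_iff_posSemidef.2 (hdec.nonneg l hl))
      (hdec.commute l hl)
      (smul_le_mul_self_of_le_spectralGap (hBar_nonneg hH0 l) (zero_mem_spectrum_hBar hH0 hff hl) hγ)
      (hz l hl ▸ hgt l hl) hΔ hη hΔg n
  refine ⟨?_, fun l hl Δ η hΔ hη hΔg n => ?_⟩
  · obtain ⟨c, hc, L, hL⟩ := hgap
    set M := ‖Hb‖
    have hM : 0 ≤ M := norm_nonneg _
    -- The uniform gap bounds hold only for `l ≥ L`. Among the finitely many shorter lengths, `r`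
    -- lies below every nonzero `‖k̄‖`, so `‖k̄‖ ≤ r` forces `k̄ = 0`.
    obtain ⟨r, hr, hrL⟩ : ∃ r : ℝ, 0 < r ∧ ∀ l < L, ‖hBar Hb l - ht l‖ ≤ r →
        hBar Hb l = ht l := by
      clear hL
      induction L with
      | zero => exact ⟨1, one_pos, fun l hl => absurd hl (Nat.not_lt_zero l)⟩
      | succ L ih =>
        obtain ⟨r, hr, h⟩ := ih
        by_cases h0 : hBar Hb L = ht L
        · refine ⟨r, hr, fun l hl hlr => ?_⟩
          rcases Nat.lt_succ_iff_lt_or_eq.1 hl with hl | rfl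
          exacts [h l hl hlr, h0]
        · have hpos : 0 < ‖hBar Hb L - ht L‖ := norm_pos_iff.2 (sub_ne_zero.2 h0)
          refine ⟨min r (‖hBar Hb L - ht L‖ / 2), by positivity, fun l hl hlr => ?_⟩
          rcases Nat.lt_succ_iff_lt_or_eq.1 hl with hl | rfl
          · exact h l hl (hlr.trans (min_le_left _ _))
          · have := hlr.trans (min_le_right _ _)
            linarith
    -- With `δ ≤ c / 4` the denominator `g̃ - 2δ` exceeds `c / 2`; with `‖h̃‖ ≤ M + 1` and `δ ≤ 1`
    -- the numerator is at most `4δ(2M + 3) ≤ c² / 4`. The loss is therefore below `c`.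
    set q := min (c / 4) (c ^ 2 / (16 * (2 * M + 3))) with hq
    refine ⟨min r (min 1 q), by positivity, hdec.small _ (by positivity), fun l hl hk => ?_⟩
    rcases lt_or_ge l L with hlL | hlL
    · have heq := hrL l hlL (hk.trans (min_le_left _ _))
      have hP : IsStarProjection (segProj Hb l) := isStarProjection_segProj l
      have hh := hBar_nonneg hH0 l
      obtain ⟨γ, hγ, hγh⟩ := exists_pos_smul_le_mul_self hh
      have hcomm := hdec.commute l hl
      rw [← heq] at hcomm
      refine isGapped_ham_of_renHam hH0 hff hl hγ fun n => ?_
      -- Here `h̄ = h̃`, so adjacent terms commute exactly and `ε = 0` is admissible, with no lower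
      -- bound on `g̃` needed.
      have h := smul_renHam_le hH0 le_rfl hγh (by
        rw [zero_smul, neg_zero]
        exact add_nonneg (hcomm.symm.mul_nonneg (leftOp_nonneg hh hP) (rightOp_nonneg hh hP))
          (hcomm.mul_nonneg (rightOp_nonneg hh hP) (leftOp_nonneg hh hP))) n
      simpa using h
    · obtain ⟨hg, hgtl⟩ := hL l hlL
      set δ := min r (min 1 q) with hδ
      have hδ0 : 0 ≤ δ := (norm_nonneg _).trans hk
      have hδ1 : δ ≤ 1 := (min_le_right _ _).trans (min_le_left _ _)
      have hδq : δ ≤ q := (min_le_right _ _).trans (min_le_right _ _)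
      have hδc : δ ≤ c / 4 := hδq.trans (min_le_left _ _)
      have hδM : δ * (16 * (2 * M + 3)) ≤ c ^ 2 :=
        (le_div_iff₀ (by positivity)).1 (hδq.trans (min_le_right _ _))
      have hη : ‖ht l‖ ≤ M + 1 := by
        have h1 : ht l = hBar Hb l - (hBar Hb l - ht l) := by abel
        rw [h1]
        exact norm_sub_le_of_le (norm_hBar_le Hb hl) (hk.trans hδ1)
      refine isGapped_ham_of_renHam hH0 hff hl ?_ (hdecomp l hl hg.le hk hη (by linarith))
      rw [sub_pos, div_lt_iff₀ (by linarith)]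
      have h1 : δ * δ ≤ δ * 1 := mul_le_mul_of_nonneg_left hδ1 hδ0
      have h2 : c * (c / 2) < c * (gt l - 2 * δ) := mul_lt_mul_of_pos_left (by linarith) hc
      nlinarith
  · refine EReal.sub_le_of_le_add ?_
    -- The gap of `h̄` may be `⊤`, so it is approached through real `γ` below it.
    refine EReal.ge_of_forall_gt_iff_ge.1 fun γ hγ => ?_
    have h := le_spectralGap (renHam_nonneg hH0 l n) (zero_mem_spectrum_renHam hH0 hff hl n)
      (hdecomp l hl hγ.le hΔ hη hΔg n)
    rw [EReal.coe_sub] at h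
    exact (EReal.sub_le_iff_le_add (.inl (EReal.coe_ne_bot _)) (.inl (EReal.coe_ne_top _))).1 h
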